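/- **Theorem (Higher regularity estimates at free boundary points).** Let $n\ge 1$, let $B_r\subset\mathbb R^n$ be the open ball of radius $r$ centred at $0$, and let $$1<p<\infty,\qquad \theta>0,\qquad \theta<\sigma<1+\theta,\qquad 0\le m<1+\theta,\qquad \alpha>0 .$$ Let $\mathfrak B\in C^0(\overline{B_1};\mathbb R^n)$, $\varrho\in C^0(\overline{B_1})$ and $\mathscr H(\xi,x)=\langle \mathfrak B(x),\xi\rangle|\xi|^\theta+\varrho(x)|\xi|^\sigma$. Let $F\subset B_1$ be compact and non-empty, and let $\mathfrak f\in C^0(B_1)$ satisfy $$c_1\,\mathrm{dist}(x,F)^\alpha\le \mathfrak f(x)\le c_2\,\mathrm{dist}(x,F)^\alpha\qquad (x\in B_1)$$ with constants $c_1>0$ and $c_2$. Let $u\in C^0(B_1)$ be a non-negative, bounded viscosity solution of $$|\nabla u|^\theta\Delta_p^{\mathrm N}u+\mathscr H(\nabla u,x)=\mathfrak f(x)\,u_+^m\quad\text{in }B_1,\qquad \Delta_p^{\mathrm N}u=\Delta u+(p-2)\Big\langle D^2u\,\tfrac{\nabla u}{|\nabla u|},\tfrac{\nabla u}{|\nabla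 u|}\Big\rangle$$ (with $u_+^m\equiv 1$ if $m=0$). If $\varrho\not\equiv 0$ in $B_1$ (the sublinear case), assume in addition that $$\alpha\le\frac{\sigma-m(2+\theta-\sigma)}{1+\theta-\sigma}\qquad\text{and}\qquad m\le\frac{\sigma}{2+\theta-\sigma}.$$ Then, for every $x_0\in B_{1/2}\cap\mathfrak f^{-1}(0)\cap\partial\{u>0\}$, $$u(x)\le C\,\max\{1,\|u\|_{L^\infty(B_1)}\}\,|x-x_0|^{\frac{2+\theta+\alpha}{1+\theta-m}}\qquad\text{for every }x\in\{u>0\}\cap B_{1/2},$$ where $C>0$ depends only on $n,p,\theta,\sigma,m,\alpha,c_1,c_2$ and on upper bounds for $\|\mathfrak B\|_{L^\infty(B_1)}$ and $\|\varrho\|_{L^\infty(B_1)}$. Here $u$ is a viscosity subsolution (respectively supersolution) if, whenever $\phi\in C^2(B_1)$ and $u-\phi$ has a local maximum (respectively minimum) at $y\in B_1$, the following holds. If $\nabla\phi(y)\ne0$, then $|\nabla\phi(y)|^\theta\Delta_p^{\mathrm N}\phi(y)+\mathscr H(\nabla\phi(y),y)\ge \mathfrak f(y)u_+^m(y)$ (respectively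 $\le$). If $\nabla\phi(y)=0$, then $\Delta\phi(y)+(p-2)\lambda\ge\mathfrak f(y)u_+^m(y)$ (respectively $\le$), where $\lambda$ is the largest eigenvalue of $D^2\phi(y)$ for subsolutions with $p\ge2$ and for supersolutions with $p<2$, and the smallest eigenvalue in the other two cases. A viscosity solution is a function that is both. -/

import Mathlib

open MeasureTheory Metric Set
open scoped ENNReal

noncomputable section

/-- The Hessian bilinear form of `φ` at `x`. -/
def hessianForm {n : ℕ} (φ : EuclideanSpace ℝ (Fin n) → ℝ) (x ξ η : EuclideanSpace ℝ (Fin n)) : ℝ :=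
  fderiv ℝ (fderiv ℝ φ) x ξ η

/-- The largest eigenvalue of the Hessian of `φ` at `x`, as the maximum of its Rayleigh quotient. -/
def hessianMax {n : ℕ} (φ : EuclideanSpace ℝ (Fin n) → ℝ) (x : EuclideanSpace ℝ (Fin n)) : ℝ :=
  sSup {t : ℝ | ∃ ξ : EuclideanSpace ℝ (Fin n), ‖ξ‖ = 1 ∧ t = hessianForm φ x ξ ξ}

/-- The smallest eigenvalue of the Hessian of `φ` at `x`, as the minimum of its Rayleigh quotient. -/
def hessianMin {n : ℕ} (φ : EuclideanSpace ℝ (Fin n) → ℝ) (x : EuclideanSpace ℝ (Fin n)) : ℝ :=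
  sInf {t : ℝ | ∃ ξ : EuclideanSpace ℝ (Fin n), ‖ξ‖ = 1 ∧ t = hessianForm φ x ξ ξ}

/-- The normalized `p`-Laplacian `Δφ + (p - 2) ⟨D²φ ∇φ/|∇φ|, ∇φ/|∇φ|⟩`; it is only used at points
where the gradient of `φ` does not vanish. -/
def normalizedPLaplacian {n : ℕ} (p : ℝ) (φ : EuclideanSpace ℝ (Fin n) → ℝ)
    (x : EuclideanSpace ℝ (Fin n)) : ℝ :=
  Laplacian.laplacian φ x +
    (p - 2) * hessianForm φ x (‖gradient φ x‖⁻¹ • gradient φ x) (‖gradient φ x‖⁻¹ • gradient φ x)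

/-- The Hamiltonian `⟨B(x), ξ⟩ |ξ|^θ + ϱ(x) |ξ|^σ`. -/
def hamiltonian {n : ℕ} (θ σ : ℝ) (B : EuclideanSpace ℝ (Fin n) → EuclideanSpace ℝ (Fin n))
    (ϱ : EuclideanSpace ℝ (Fin n) → ℝ) (ξ x : EuclideanSpace ℝ (Fin n)) : ℝ :=
  inner ℝ (B x) ξ * ‖ξ‖ ^ θ + ϱ x * ‖ξ‖ ^ σ

/-- `u` is a viscosity subsolution of `|∇u|^θ Δ_p^N u + H(∇u, x) = f₀(x, u)` in `Ω`. The test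
function touches `u` from above up to an additive constant, so the right-hand side is evaluated
at the common value `u x₀`. -/
def IsViscositySubsolution {n : ℕ} (p θ : ℝ)
    (H : EuclideanSpace ℝ (Fin n) → EuclideanSpace ℝ (Fin n) → ℝ)
    (f₀ : EuclideanSpace ℝ (Fin n) → ℝ → ℝ) (Ω : Set (EuclideanSpace ℝ (Fin n)))
    (u : EuclideanSpace ℝ (Fin n) → ℝ) : Prop :=
  ∀ φ : EuclideanSpace ℝ (Fin n) → ℝ, ContDiffOn ℝ 2 φ Ω →
    ∀ x₀ ∈ Ω, IsLocalMax (fun x => u x - φ x) x₀ →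
      (gradient φ x₀ ≠ 0 →
        f₀ x₀ (u x₀) ≤
          ‖gradient φ x₀‖ ^ θ * normalizedPLaplacian p φ x₀ + H (gradient φ x₀) x₀) ∧
      (gradient φ x₀ = 0 →
        (2 ≤ p → f₀ x₀ (u x₀) ≤ Laplacian.laplacian φ x₀ + (p - 2) * hessianMax φ x₀) ∧
        (p < 2 → f₀ x₀ (u x₀) ≤ Laplacian.laplacian φ x₀ + (p - 2) * hessianMin φ x₀))

/-- `u` is a viscosity supersolution of `|∇u|^θ Δ_p^N u + H(∇u, x) = f₀(x, u)` in `Ω`. -/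
def IsViscositySupersolution {n : ℕ} (p θ : ℝ)
    (H : EuclideanSpace ℝ (Fin n) → EuclideanSpace ℝ (Fin n) → ℝ)
    (f₀ : EuclideanSpace ℝ (Fin n) → ℝ → ℝ) (Ω : Set (EuclideanSpace ℝ (Fin n)))
    (u : EuclideanSpace ℝ (Fin n) → ℝ) : Prop :=
  ∀ φ : EuclideanSpace ℝ (Fin n) → ℝ, ContDiffOn ℝ 2 φ Ω →
    ∀ x₀ ∈ Ω, IsLocalMin (fun x => u x - φ x) x₀ →
      (gradient φ x₀ ≠ 0 →
        ‖gradient φ x₀‖ ^ θ * normalizedPLaplacian p φ x₀ + H (gradient φ x₀) x₀ ≤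
          f₀ x₀ (u x₀)) ∧
      (gradient φ x₀ = 0 →
        (2 ≤ p → Laplacian.laplacian φ x₀ + (p - 2) * hessianMin φ x₀ ≤ f₀ x₀ (u x₀)) ∧
        (p < 2 → Laplacian.laplacian φ x₀ + (p - 2) * hessianMax φ x₀ ≤ f₀ x₀ (u x₀)))

/-- `u` is a (continuous) viscosity solution of `|∇u|^θ Δ_p^N u + H(∇u, x) = f₀(x, u)` in `Ω`. -/
def IsViscositySolution {n : ℕ} (p θ : ℝ)
    (H : EuclideanSpace ℝ (Fin n) → EuclideanSpace ℝ (Fin n) → ℝ)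
    (f₀ : EuclideanSpace ℝ (Fin n) → ℝ → ℝ) (Ω : Set (EuclideanSpace ℝ (Fin n)))
    (u : EuclideanSpace ℝ (Fin n) → ℝ) : Prop :=
  ContinuousOn u Ω ∧ IsViscositySubsolution p θ H f₀ Ω u ∧ IsViscositySupersolution p θ H f₀ Ω u

/-- The norm of `u` in `L^∞(Ω)`, a real number when `u` is bounded on `Ω`. -/
def linftyNorm {n : ℕ} (Ω : Set (EuclideanSpace ℝ (Fin n)))
    (u : EuclideanSpace ℝ (Fin n) → ℝ) : ℝ :=
  (eLpNorm u ∞ (volume.restrict Ω)).toReal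

end

/-! ### Second order expansions of semiconvex functions near a strict maximum. -/

section SecondOrder

open Filter Topology

variable {V : Type*} [NormedAddCommGroup V] [NormedSpace ℝ V]

/-! The estimate is an iteration over balls centred at the free boundary point `x₀`. Put `β = (2 + θ
+ α) / (1 + θ - m)`, suppose `u ≤ A ρ ^ β` on the ball of radius `ρ`, and rescale: `v y = u (x₀ + (ρ
/ 4) y) / (A ρ ^ β)`. Since `x₀ ∈ F`, the right-hand side is at most `|c₂| ρ ^ α (A ρ ^ β) ^ m`
there, and `β` is exactly the exponent for which this scales like the operator. The drift gains a
factor `ρ`, and the upper bound on `α` keeps the term in `ϱ` under control. So for `A` large and `ρ`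
small, `v` and `-v` are both subsolutions of one extremal equation whose lower order terms carry a
small factor `δ` (`IsViscositySolution.isExtremalSubsolution_rescaled`, `rescaled_coefficients_le`).
Also `0 ≤ v ≤ 1` and `v 0 = 0`. By `exists_flatness_improvement`, `v ≤ (1 / 4) ^ β` on the unit
ball, which is the same bound for `u` at scale `ρ / 4`. `le_of_geometric_decay` sums up the
iteration.

Flatness improvement is quantitative and needs no compactness argument. If `v x₁ > η`, the Hölder
estimate `exists_holder_estimate`, whose constant does not depend on `δ ≤ 1`, keeps `v ≥ η / 2` on a
ball of fixed radius around `x₁`. A Gaussian barrier (`pos_of_barrier`) then propagates positivity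
up to the origin as soon as `δ` is small, contradicting `v 0 = 0`. Both arguments test the equation
only where the gradient is nonzero, so the degenerate clause of the definition of solution never
enters.

The Hölder estimate is of Ishii-Lions type: double the variables with the concave modulus `L |x - y|
^ (1 / 2)`. At a maximum the slope is large, hence the degeneracy can be divided out, and the
concavity of the modulus contributes a very negative second derivative in the direction `x - y`.
Comparing the two Hessians in bases related by a reflection (`jetPLaplacian_add_le`) isolates this
term. The Hessians come from a theorem on sums for sup-convolutions (`exists_jets_of_doubling`),
deduced from a Jensen-type lemma (`exists_second_order_expansion`): on the set where small affine
functions touch from above, the slopes are Lipschitz and cover a ball, so this set has positive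
measure and Rademacher's theorem provides a point of second order expansion. -/

/-- `w` is touched from below at every point by a paraboloid of opening `K`. -/
def HasLowerParaboloids (K : ℝ) (w : V → ℝ) : Prop :=
  ∀ z, ∃ ℓ : V →L[ℝ] ℝ, ∀ z', w z + ℓ (z' - z) - K * ‖z' - z‖ ^ 2 ≤ w z'

/-- Vectors of length `t` balance the two terms on the right and give the bound. For `t = 0` that
sphere is degenerate, and one lets the radius of the test sphere tend to zero. -/
theorem ContinuousLinearMap.norm_le_of_apply_le_sq {ℓ : V →L[ℝ] ℝ} {K t ρ : ℝ} (hK : 0 ≤ K)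
    (ht : 0 ≤ t) (htρ : t < ρ) (h : ∀ v : V, ‖v‖ ≤ ρ → ℓ v ≤ K * ‖v‖ ^ 2 + K * t ^ 2) :
    ‖ℓ‖ ≤ 2 * K * t := by
  have key : ∀ s, 0 < s → s ≤ ρ → t ≤ s → ‖ℓ‖ ≤ 2 * K * s := by
    intro s hs hsρ hts
    have h1 : ∀ v : V, ℓ v ≤ 2 * K * s * ‖v‖ := by
      intro v
      rcases eq_or_ne v 0 with rfl | hv
      · simp
      have hv' : 0 < ‖v‖ := norm_pos_iff.2 hv
      have hn : ‖(s / ‖v‖) • v‖ = s := by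
        rw [norm_smul, Real.norm_of_nonneg (by positivity)]; field_simp
      have h2 := h ((s / ‖v‖) • v) (by rw [hn]; exact hsρ)
      rw [hn, map_smul, smul_eq_mul] at h2
      have h3 : s / ‖v‖ * ℓ v ≤ 2 * K * s ^ 2 := by nlinarith [pow_le_pow_left₀ ht hts 2]
      have h4 : s / ‖v‖ * ℓ v = s * (ℓ v / ‖v‖) := by ring
      rw [h4] at h3
      have h5 : ℓ v / ‖v‖ ≤ 2 * K * s := by
        by_contra hc
        push Not at hc
        nlinarith
      rwa [div_le_iff₀ hv'] at h5
    refine ℓ.opNorm_le_bound (by positivity) fun v => ?_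
    rw [Real.norm_eq_abs, abs_le]
    refine ⟨?_, h1 v⟩
    have := h1 (-v)
    rw [map_neg, norm_neg] at this
    linarith
  rcases ht.eq_or_lt with rfl | ht'
  · have : Tendsto (fun s : ℝ => 2 * K * s) (𝓝[>] 0) (𝓝 (2 * K * 0)) :=
      ((continuous_const.mul continuous_id).tendsto 0).mono_left nhdsWithin_le_nhds
    refine ge_of_tendsto this ?_
    filter_upwards [Ioo_mem_nhdsGT htρ] with s hs
    exact key s hs.1 hs.2.le hs.1.le
  · exact key t ht' htρ.le le_rfl

theorem eq_slope {w : V → ℝ} {K ρ : ℝ} (hK : 0 ≤ K) (hρ : 0 < ρ) {ℓ : V → V →L[ℝ] ℝ}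
    (hℓ : ∀ z z', w z + ℓ z (z' - z) - K * ‖z' - z‖ ^ 2 ≤ w z') {s : V} {p : V →L[ℝ] ℝ}
    (hp : ∀ z', ‖z' - s‖ ≤ ρ → w z' ≤ w s + p (z' - s)) : ℓ s = p := by
  have h0 : ‖ℓ s - p‖ ≤ 2 * K * 0 := by
    refine ContinuousLinearMap.norm_le_of_apply_le_sq (ρ := ρ) hK le_rfl hρ fun v hv => ?_
    have h1 := hℓ s (s + v)
    have h2 := hp (s + v) (by simpa using hv)
    simp only [add_sub_cancel_left, _root_.sub_apply] at h1 h2 ⊢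
    linarith
  rw [mul_zero] at h0
  exact sub_eq_zero.1 (norm_le_zero_iff.1 h0)

/-- If `w` is touched from above by an affine function at `s`, the slopes of paraboloids touching
from below vary in a Lipschitz way at `s`. -/
theorem slope_dist_le {w : V → ℝ} {K ρ : ℝ} (hK : 0 ≤ K) {ℓ : V → V →L[ℝ] ℝ}
    (hℓ : ∀ z z', w z + ℓ z (z' - z) - K * ‖z' - z‖ ^ 2 ≤ w z') {s z : V} {p : V →L[ℝ] ℝ}
    (hp : ∀ z', ‖z' - s‖ ≤ 2 * ρ → w z' ≤ w s + p (z' - s)) (hz : ‖z - s‖ < ρ) :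
    ‖ℓ z - ℓ s‖ ≤ 2 * K * ‖z - s‖ := by
  have hρ : 0 < ρ := (norm_nonneg _).trans_lt hz
  have hps : ℓ s = p := eq_slope hK (by positivity) hℓ hp
  subst hps
  -- At `z + v`, the paraboloid based at `z` lies below the affine function based at `s`. The
  -- unknown value `w z` is eliminated with the paraboloid based at `s`.
  refine ContinuousLinearMap.norm_le_of_apply_le_sq (ρ := ρ) hK (norm_nonneg _) hz fun v hv => ?_
  have h1 := hℓ z (z + v)
  have h2 := hp (z + v) (by
    have : z + v - s = (z - s) + v := by abel
    rw [this]
    exact (norm_add_le _ _).trans (by linarith))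
  have h3 := hℓ s z
  have h4 : z + v - s = (z - s) + v := by abel
  rw [h4, map_add] at h2
  simp only [add_sub_cancel_left, _root_.sub_apply] at h1 ⊢
  linarith

/-- A substitute for integrating `g' = c` when `g` is not known to be differentiable: over `N` equal
steps the quadratic errors add up to `C / N`, which disappears in the limit. -/
theorem abs_sub_le_of_slope_bounds {g c : ℝ → ℝ} {e C : ℝ}
    (hc : ∀ t ∈ Icc (0 : ℝ) 1, |c t| ≤ e)
    (hg : ∀ t ∈ Icc (0 : ℝ) 1, ∀ t' ∈ Icc (0 : ℝ) 1,
      c t * (t' - t) - C * (t' - t) ^ 2 ≤ g t' - g t) : |g 1 - g 0| ≤ e := by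
  have h1 : ∀ t ∈ Icc (0 : ℝ) 1, ∀ t' ∈ Icc (0 : ℝ) 1,
      |g t' - g t| ≤ e * |t' - t| + C * (t' - t) ^ 2 := by
    have h0 : ∀ t ∈ Icc (0 : ℝ) 1, ∀ t' ∈ Icc (0 : ℝ) 1,
        -(e * |t' - t| + C * (t' - t) ^ 2) ≤ g t' - g t := by
      intro t ht t' ht'
      have h2 : |c t * (t' - t)| ≤ e * |t' - t| := by
        rw [abs_mul]; exact mul_le_mul_of_nonneg_right (hc t ht) (abs_nonneg _)
      linarith [hg t ht t' ht', neg_abs_le (c t * (t' - t))]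
    intro t ht t' ht'
    refine abs_le.2 ⟨h0 t ht t' ht', ?_⟩
    have := h0 t' ht' t ht
    rw [abs_sub_comm t t', show (t - t') ^ 2 = (t' - t) ^ 2 by ring] at this
    linarith
  have h2 : ∀ N : ℕ, 0 < N → |g 1 - g 0| ≤ e + C / N := by
    intro N hN
    have hN' : (0 : ℝ) < N := by exact_mod_cast hN
    have htel : g 1 - g 0 = ∑ i ∈ Finset.range N, (g ((i + 1 : ℕ) / N) - g ((i : ℕ) / N)) := by
      rw [Finset.sum_range_sub (fun i : ℕ => g (i / N))]
      simp [hN'.ne']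
    rw [htel]
    have hterm : ∀ i ∈ Finset.range N,
        |g ((i + 1 : ℕ) / N) - g ((i : ℕ) / N)| ≤ e * (1 / N) + C * (1 / N) ^ 2 := by
      intro i hi
      have hi' : (i : ℝ) + 1 ≤ N := by exact_mod_cast Finset.mem_range.1 hi
      have hi0 : (0 : ℝ) ≤ i := Nat.cast_nonneg i
      have h3 := h1 (i / N) ⟨by positivity, by rw [div_le_one hN']; linarith⟩
        ((i + 1 : ℕ) / N) ⟨by positivity, by rw [div_le_one hN']; push_cast; linarith⟩
      have h4 : (((i + 1 : ℕ) : ℝ) / N - i / N) = 1 / N := by push_cast; ring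
      rwa [h4, abs_of_nonneg (one_div_nonneg.2 hN'.le)] at h3
    refine (Finset.abs_sum_le_sum_abs _ _).trans ((Finset.sum_le_sum hterm).trans ?_)
    rw [Finset.sum_const, Finset.card_range, nsmul_eq_mul]
    apply le_of_eq
    field_simp
  have h3 : Tendsto (fun N : ℕ => e + C / (N : ℝ)) atTop (𝓝 (e + 0)) :=
    tendsto_const_nhds.add (tendsto_const_div_atTop_nhds_zero_nat C)
  rw [add_zero] at h3
  refine ge_of_tendsto h3 ?_
  filter_upwards [eventually_gt_atTop 0] with N hN
  exact h2 N hN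

/-- A function touched from below by paraboloids whose slopes are differentiable at `z` has a second
order expansion at `z`. -/
theorem expansion_of_slope_hasFDerivAt {w : V → ℝ} {K : ℝ} {ℓ : V → V →L[ℝ] ℝ}
    (hℓ : ∀ z z', w z + ℓ z (z' - z) - K * ‖z' - z‖ ^ 2 ≤ w z') {z : V}
    {D : V →L[ℝ] V →L[ℝ] ℝ}
    (hD : ∀ ε > 0, ∀ᶠ h in 𝓝 (0 : V), ‖ℓ (z + h) - ℓ z - D h‖ ≤ ε * ‖h‖) :
    ∀ ε > 0, ∀ᶠ h in 𝓝 (0 : V),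
      |w (z + h) - w z - ℓ z h - 1 / 2 * D h h| ≤ ε * ‖h‖ ^ 2 := by
  intro ε hε
  obtain ⟨r, hr, hr'⟩ := Metric.eventually_nhds_iff.1 (hD ε hε)
  filter_upwards [Metric.ball_mem_nhds (0 : V) hr] with h hh
  have hh' : ‖h‖ < r := by simpa using hh
  let g : ℝ → ℝ := fun t => w (z + t • h) - t * ℓ z h - t ^ 2 / 2 * D h h
  let c : ℝ → ℝ := fun t => (ℓ (z + t • h) - ℓ z - D (t • h)) h
  have hc : ∀ t ∈ Icc (0 : ℝ) 1, |c t| ≤ ε * ‖h‖ ^ 2 := by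
    intro t ht
    have hn : ‖t • h‖ ≤ ‖h‖ := by
      rw [norm_smul, Real.norm_of_nonneg ht.1]
      exact mul_le_of_le_one_left (norm_nonneg _) ht.2
    have h1 := hr' (y := t • h) (by rw [dist_zero_right]; exact hn.trans_lt hh')
    refine ((ℓ (z + t • h) - ℓ z - D (t • h)).le_opNorm h).trans ?_
    calc _ ≤ ε * ‖t • h‖ * ‖h‖ := by gcongr
      _ ≤ ε * ‖h‖ * ‖h‖ := by gcongr
      _ = _ := by ring
  have hg : ∀ t ∈ Icc (0 : ℝ) 1, ∀ t' ∈ Icc (0 : ℝ) 1,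
      c t * (t' - t) - (K * ‖h‖ ^ 2 + 1 / 2 * D h h) * (t' - t) ^ 2 ≤ g t' - g t := by
    intro t _ t' _
    have h1 := hℓ (z + t • h) (z + t' • h)
    have h2 : z + t' • h - (z + t • h) = (t' - t) • h := by rw [sub_smul]; abel
    rw [h2, norm_smul, map_smul, smul_eq_mul, mul_pow, Real.norm_eq_abs, sq_abs] at h1
    simp only [g, c, _root_.sub_apply, map_smul, _root_.smul_apply,
      smul_eq_mul]
    linarith
  have := abs_sub_le_of_slope_bounds hc hg
  simp only [g, one_smul, zero_smul, add_zero] at this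
  convert this using 2
  ring

variable [FiniteDimensional ℝ V]

/-- Near a strict maximum point, a function touched from below by paraboloids of a fixed opening has
a second order expansion at points of maximum of small affine perturbations. -/
theorem exists_second_order_expansion {w : V → ℝ} {K ε ρ τ : ℝ} {z₀ : V} (hw : Continuous w)
    (hK : 0 ≤ K) (hpar : HasLowerParaboloids K w) (hε : 0 < ε) (hρ : 0 < ρ)
    (hmax : ∀ z ∈ closedBall z₀ ρ, w z ≤ w z₀ - ε * ‖z - z₀‖ ^ 2) (hτ : 0 < τ) :
    ∃ z ∈ ball z₀ τ, ∃ p : V →L[ℝ] ℝ, ∃ D : V →L[ℝ] V →L[ℝ] ℝ, ‖p‖ ≤ τ ∧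
      (∀ e > 0, ∀ᶠ h in 𝓝 (0 : V), |w (z + h) - w z - p h - 1 / 2 * D h h| ≤ e * ‖h‖ ^ 2) ∧
      ∀ᶠ h in 𝓝 (0 : V), w (z + h) ≤ w z + p h := by
  choose ℓ hℓ using hpar
  obtain ⟨δ, hδ, hδτ, hδ1⟩ : ∃ δ, 0 < δ ∧ δ ≤ τ ∧ δ / ε < min (ρ / 8) τ := by
    -- A slope of size `δ` moves the maximum by at most `δ / ε`, which must stay well inside the
    -- ball of radius `ρ`.
    have hm : 0 < min (ρ / 8) τ := by positivity
    refine ⟨min τ (ε * (min (ρ / 8) τ / 2)), by positivity, min_le_left _ _, ?_⟩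
    rw [div_lt_iff₀ hε]
    calc _ ≤ ε * (min (ρ / 8) τ / 2) := min_le_right _ _
      _ < _ := by nlinarith
  -- The contact set: points where an affine function of slope at most `δ` touches from above.
  let S : Set V := {z | z ∈ closedBall z₀ (δ / ε) ∧ ∃ p : V →L[ℝ] ℝ, ‖p‖ ≤ δ ∧
    ∀ z' ∈ closedBall z₀ ρ, w z' ≤ w z + p (z' - z)}
  have hSs : ∀ s ∈ S, ∃ p : V →L[ℝ] ℝ, ‖p‖ ≤ δ ∧
      ∀ z', ‖z' - s‖ ≤ 2 * (ρ / 4) → w z' ≤ w s + p (z' - s) := by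
    rintro s ⟨hs, p, hp, hp'⟩
    refine ⟨p, hp, fun z' hz' => hp' z' ?_⟩
    rw [mem_closedBall, dist_eq_norm] at hs ⊢
    have h1 : z' - z₀ = (z' - s) + (s - z₀) := by abel
    rw [h1]
    have := hδ1.trans_le (min_le_left _ _)
    exact (norm_add_le _ _).trans (by linarith)
  have hlip : ∀ s ∈ S, ∀ z, ‖z - s‖ < ρ / 4 → ‖ℓ z - ℓ s‖ ≤ 2 * K * ‖z - s‖ := by
    intro s hs z hz
    obtain ⟨p, _, hp⟩ := hSs s hs
    exact slope_dist_le hK hℓ hp hz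
  have hslope : ∀ s ∈ S, ∀ p : V →L[ℝ] ℝ, (∀ z' ∈ closedBall z₀ ρ, w z' ≤ w s + p (z' - s)) →
      ℓ s = p := by
    intro s hs p hp
    refine eq_slope (ρ := ρ / 4) hK (by positivity) hℓ fun z' hz' => hp z' ?_
    have hs' := hs.1
    rw [mem_closedBall, dist_eq_norm] at hs' ⊢
    have h3 : z' - z₀ = (z' - s) + (s - z₀) := by abel
    rw [h3]
    have := hδ1.trans_le (min_le_left _ _)
    exact (norm_add_le _ _).trans (by linarith)
  have hLip : LipschitzOnWith (2 * K).toNNReal ℓ S := by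
    refine LipschitzOnWith.of_dist_le_mul fun x hx y hy => ?_
    rw [Real.coe_toNNReal _ (by positivity), dist_eq_norm, dist_eq_norm]
    refine hlip y hy x ?_
    have h1 := hx.1
    have h2 := hy.1
    rw [mem_closedBall, dist_eq_norm] at h1 h2
    have h3 : x - y = (x - z₀) - (y - z₀) := by abel
    rw [h3]
    have := hδ1.trans_le (min_le_left _ _)
    exact (norm_sub_le _ _).trans_lt (by linarith)
  have himage : closedBall (0 : V →L[ℝ] ℝ) δ ⊆ ℓ '' S := by
    intro p hp
    rw [mem_closedBall_zero_iff] at hp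
    obtain ⟨z, hz, hzmax⟩ := (isCompact_closedBall z₀ ρ).exists_isMaxOn
      (nonempty_closedBall.2 hρ.le) (f := fun z => w z - p z) (by fun_prop)
    have hz1 : ∀ z' ∈ closedBall z₀ ρ, w z' ≤ w z + p (z' - z) := by
      intro z' hz'
      have : w z' - p z' ≤ w z - p z := hzmax hz'
      rw [map_sub]; linarith
    have hz2 : ‖z - z₀‖ ≤ δ / ε := by
      have h1 := hz1 z₀ (mem_closedBall_self hρ.le)
      have h2 := hmax z hz
      have h3 : p (z₀ - z) ≤ δ * ‖z - z₀‖ := by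
        refine (le_abs_self _).trans ((p.le_opNorm _).trans ?_)
        rw [norm_sub_rev]
        gcongr
      rw [le_div_iff₀ hε]
      by_contra hc
      push Not at hc
      have h4 : 0 < ‖z - z₀‖ := by
        rcases (norm_nonneg (z - z₀)).eq_or_lt with h | h
        · rw [← h] at hc; linarith
        · exact h
      nlinarith
    have hzS : z ∈ S := ⟨by rwa [mem_closedBall, dist_eq_norm], p, hp, hz1⟩
    exact ⟨z, hzS, hslope z hzS p hz1⟩
  borelize V
  borelize (V →L[ℝ] ℝ)
  have hfin : Module.finrank ℝ (V →L[ℝ] ℝ) = Module.finrank ℝ V := by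
    rw [← LinearMap.toContinuousLinearMap.finrank_eq]
    exact Subspace.dual_finrank_eq
  let μ : Measure V := μH[(Module.finrank ℝ V : ℝ)]
  -- A Lipschitz map cannot send a null set onto a set containing a ball of the same dimension.
  have hμS : μ S ≠ 0 := by
    intro h0
    have h1 := hLip.hausdorffMeasure_image_le (d := Module.finrank ℝ V) (Nat.cast_nonneg _)
    have h2 : (μH[(Module.finrank ℝ V : ℝ)] : Measure V) S = 0 := h0
    rw [h2, mul_zero, ← hfin] at h1
    have h3 : 0 < (μH[(Module.finrank ℝ (V →L[ℝ] ℝ) : ℝ)] : Measure (V →L[ℝ] ℝ))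
        (closedBall 0 δ) := measure_closedBall_pos _ _ hδ
    exact absurd (h3.trans_le (measure_mono himage)) (not_lt.2 h1)
  -- Density is needed along balls that are not centred at `x`: below they are centred at `z + h`
  -- with radius `e * ‖h‖`, so that every nearby point is approximated by a point of `S`.
  have hae : ∀ᵐ x ∂μ.restrict S, ∀ k : ℕ, ∀ (c : V → V) (r : V → ℝ),
      Tendsto r (𝓝[≠] 0) (𝓝[>] 0) → (∀ᶠ j in 𝓝[≠] 0, x ∈ closedBall (c j) (k * r j)) →
      Tendsto (fun j => μ (S ∩ closedBall (c j) (r j)) / μ (closedBall (c j) (r j)))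
        (𝓝[≠] 0) (𝓝 1) :=
    ae_all_iff.2 fun k => (IsUnifLocDoublingMeasure.ae_tendsto_measure_inter_div μ S k).mono
      fun x hx c r => hx c r
  have hdiff := ae_restrict_of_ae (s := S) (hLip.ae_differentiableWithinAt_of_mem (μ := μ))
  have hmemS : ∃ᵐ x ∂μ.restrict S, x ∈ S := by
    intro h0
    have h1 : (μ.restrict S) S = 0 := measure_mono_null (fun x hx => by simpa using hx) h0
    rw [Measure.restrict_apply_self] at h1
    exact hμS h1
  obtain ⟨z, ⟨hzd', hzdens⟩, hzS⟩ := ((hdiff.and hae).and_frequently hmemS).exists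
  have hzd := hzd' hzS
  have hdense : ∀ e > 0, ∀ᶠ h in 𝓝 (0 : V), ∃ s ∈ S, ‖z + h - s‖ ≤ e * ‖h‖ := by
    intro e he
    obtain ⟨k, hk⟩ := exists_nat_gt (1 / e)
    have h1 := hzdens k (fun h => z + h) (fun h => e * ‖h‖) (by
      refine tendsto_nhdsWithin_iff.2 ⟨?_, ?_⟩
      · have : Tendsto (fun h : V => e * ‖h‖) (𝓝 0) (𝓝 (e * ‖(0 : V)‖)) :=
          (by fun_prop : Continuous fun h : V => e * ‖h‖).tendsto 0
        rw [norm_zero, mul_zero] at this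
        exact this.mono_left nhdsWithin_le_nhds
      · filter_upwards [self_mem_nhdsWithin] with h hh
        exact mul_pos he (norm_pos_iff.2 hh)) (by
      filter_upwards with h
      rw [mem_closedBall, dist_eq_norm]
      have : z - (z + h) = -h := by abel
      rw [this, norm_neg]
      have : 1 ≤ k * e := by rw [div_lt_iff₀ he] at hk; exact hk.le
      calc ‖h‖ = 1 * ‖h‖ := (one_mul _).symm
        _ ≤ (k * e) * ‖h‖ := by gcongr
        _ = _ := by ring)
    have h2 := h1.eventually (lt_mem_nhds (zero_lt_one' ℝ≥0∞))
    rw [eventually_nhdsWithin_iff] at h2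
    filter_upwards [h2] with h hh
    rcases eq_or_ne h 0 with rfl | h0
    · exact ⟨z, hzS, by simp⟩
    have h3 : μ (S ∩ closedBall (z + h) (e * ‖h‖)) ≠ 0 := by
      intro h4
      have := hh h0
      rw [h4, ENNReal.zero_div] at this
      exact lt_irrefl _ this
    obtain ⟨s, hs, hs'⟩ := nonempty_of_measure_ne_zero h3
    refine ⟨s, hs, ?_⟩
    rw [mem_closedBall, dist_comm, dist_eq_norm] at hs'
    exact hs'
  obtain ⟨D, hD⟩ := hzd
  -- Differentiability relative to `S` becomes full differentiability: compare `z + h` with a point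
  -- `s ∈ S` at distance `e₁ * ‖h‖`, using that slopes are Lipschitz at `s` against all nearby
  -- points, not only those of `S`.
  have hDz : ∀ e > 0, ∀ᶠ h in 𝓝 (0 : V), ‖ℓ (z + h) - ℓ z - D h‖ ≤ e * ‖h‖ := by
    intro e he
    have hC : 0 < 2 * K + ‖D‖ + 1 := by positivity
    let e₁ := min 1 (e / (2 * (2 * K + ‖D‖ + 1)))
    have he₁ : 0 < e₁ := by positivity
    have he₁' : (2 * K + ‖D‖ + 1) * e₁ ≤ e / 2 := by
      calc _ ≤ (2 * K + ‖D‖ + 1) * (e / (2 * (2 * K + ‖D‖ + 1))) := by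
            gcongr; exact min_le_right _ _
        _ = e / 2 := by field_simp
    have h1 := hD.isLittleO.def (show 0 < e / 4 by positivity)
    rw [eventually_nhdsWithin_iff] at h1
    obtain ⟨r, hr, hr'⟩ := Metric.eventually_nhds_iff.1 h1
    filter_upwards [hdense e₁ he₁, Metric.ball_mem_nhds (0 : V) (half_pos hr),
      Metric.ball_mem_nhds (0 : V) (show 0 < ρ / 4 by positivity)] with h hs hh hh2
    obtain ⟨s, hs, hsh⟩ := hs
    rw [mem_ball_zero_iff] at hh hh2
    have hsh1 : ‖z + h - s‖ ≤ ‖h‖ :=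
      hsh.trans (mul_le_of_le_one_left (norm_nonneg _) (min_le_left _ _))
    have hsz : ‖s - z‖ ≤ 2 * ‖h‖ := by
      have : s - z = h - (z + h - s) := by abel
      rw [this]
      exact (norm_sub_le _ _).trans (by linarith)
    have h2 := hr' (y := s) (by rw [dist_eq_norm]; linarith) hs
    have h3 := hlip s hs (z + h) (hsh1.trans_lt hh2)
    have h4 : ‖D (z + h - s)‖ ≤ ‖D‖ * ‖z + h - s‖ := D.le_opNorm _
    have h5 : ℓ (z + h) - ℓ z - D h =
        (ℓ (z + h) - ℓ s) + (ℓ s - ℓ z - D (s - z)) - D (z + h - s) := by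
      simp only [map_sub, map_add]; abel
    rw [h5]
    calc _ ≤ ‖ℓ (z + h) - ℓ s‖ + ‖ℓ s - ℓ z - D (s - z)‖ + ‖D (z + h - s)‖ :=
          (norm_sub_le _ _).trans (by gcongr; exact norm_add_le _ _)
      _ ≤ 2 * K * ‖z + h - s‖ + e / 4 * ‖s - z‖ + ‖D‖ * ‖z + h - s‖ := by gcongr
      _ ≤ 2 * K * (e₁ * ‖h‖) + e / 4 * (2 * ‖h‖) + ‖D‖ * (e₁ * ‖h‖) := by gcongr
      _ ≤ e * ‖h‖ := by nlinarith [norm_nonneg h]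
  obtain ⟨p, hp, hp'⟩ := hSs z hzS
  have hpz : ℓ z = p := eq_slope hK (by positivity) hℓ hp'
  refine ⟨z, ?_, p, D, hp.trans hδτ, ?_, ?_⟩
  · rw [mem_ball]
    exact (mem_closedBall.1 hzS.1).trans_lt (hδ1.trans_le (min_le_right _ _))
  · rw [← hpz]
    exact expansion_of_slope_hasFDerivAt hℓ hDz
  · filter_upwards [Metric.ball_mem_nhds (0 : V) (show 0 < 2 * (ρ / 4) by positivity)] with h hh
    have := hp' (z + h) (by simpa using (mem_ball_zero_iff.1 hh).le)
    simpa using this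

end SecondOrder

/-! ### A theorem on sums for semiconvex functions. -/

section Doubling

open Filter Topology

namespace HasLowerParaboloids

variable {V W : Type*} [NormedAddCommGroup V] [NormedSpace ℝ V] [NormedAddCommGroup W]
  [NormedSpace ℝ W]

theorem add {K L : ℝ} {v w : V → ℝ} (hv : HasLowerParaboloids K v)
    (hw : HasLowerParaboloids L w) : HasLowerParaboloids (K + L) (fun z => v z + w z) := by
  intro z
  obtain ⟨ℓ, hℓ⟩ := hv z
  obtain ⟨k, hk⟩ := hw z
  refine ⟨ℓ + k, fun z' => ?_⟩
  have h1 := hℓ z'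
  have h2 := hk z'
  rw [_root_.add_apply]
  linarith

theorem comp_add_clm {K : ℝ} (hK : 0 ≤ K) {v : V → ℝ} (hv : HasLowerParaboloids K v) (x : V)
    (T : W →L[ℝ] V) (hT : ∀ z, ‖T z‖ ≤ ‖z‖) : HasLowerParaboloids K (fun z => v (x + T z)) := by
  intro z
  obtain ⟨ℓ, hℓ⟩ := hv (x + T z)
  refine ⟨ℓ.comp T, fun z' => ?_⟩
  have h1 := hℓ (x + T z')
  rw [add_sub_add_left_eq_sub, ← map_sub] at h1
  have h2 : K * ‖T (z' - z)‖ ^ 2 ≤ K * ‖z' - z‖ ^ 2 := by gcongr; exact hT _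
  rw [ContinuousLinearMap.comp_apply]
  linarith

theorem clm (ℓ : V →L[ℝ] ℝ) : HasLowerParaboloids 0 (fun z => ℓ z) := fun z =>
  ⟨ℓ, fun z' => by rw [map_sub]; linarith⟩

theorem neg_bilin (T : V →L[ℝ] V →L[ℝ] ℝ) : HasLowerParaboloids ‖T‖ (fun z => -T z z) := by
  intro z
  refine ⟨-(T z + T.flip z), fun z' => ?_⟩
  have h1 : T (z' - z) (z' - z) ≤ ‖T‖ * ‖z' - z‖ ^ 2 := by
    refine (le_abs_self _).trans ((T.le_opNorm₂ _ _).trans (le_of_eq ?_))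
    ring
  simp only [map_sub, _root_.neg_apply, _root_.add_apply, _root_.sub_apply,
    ContinuousLinearMap.flip_apply] at h1 ⊢
  linarith

end HasLowerParaboloids

variable {E : Type*} [NormedAddCommGroup E] [NormedSpace ℝ E]

/-- `(ξ, X)` is a second order superjet of `w` at `x`. -/
def IsUpperJet (w : E → ℝ) (x : E) (ξ : E →L[ℝ] ℝ) (X : E →L[ℝ] E →L[ℝ] ℝ) :
    Prop :=
  ∀ e > 0, ∀ᶠ h in 𝓝 (0 : E), w (x + h) ≤ w x + ξ h + 1 / 2 * X h h + e * ‖h‖ ^ 2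

variable [FiniteDimensional ℝ E]

/-- A version of the theorem on sums for functions touched from below by paraboloids. -/
theorem exists_jets_of_doubling {U W : E → ℝ} {K : ℝ} (hK : 0 ≤ K) (hU : Continuous U)
    (hW : Continuous W) (hUK : HasLowerParaboloids K U) (hWK : HasLowerParaboloids K W)
    {x₀ y₀ : E} {ξ₀ η₀ : E →L[ℝ] ℝ} {T : (E × E) →L[ℝ] (E × E) →L[ℝ] ℝ}
    (hmax : ∀ᶠ z in 𝓝 (0 : E × E), U (x₀ + z.1) + W (y₀ + z.2) ≤ U x₀ + W y₀ + ξ₀ z.1 + η₀ z.2 +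
      T z z - ‖z‖ ^ 2)
    {τ : ℝ} (hτ : 0 < τ) :
    ∃ x ∈ ball x₀ τ, ∃ y ∈ ball y₀ τ, ∃ ξ η : E →L[ℝ] ℝ, ∃ X Y : E →L[ℝ] E →L[ℝ] ℝ,
      ‖ξ - ξ₀‖ ≤ τ ∧ ‖η - η₀‖ ≤ τ ∧ IsUpperJet U x ξ X ∧ IsUpperJet W y η Y ∧
      ∀ a b, X a a + Y b b ≤ 2 * T (a, b) (a, b) := by
  set ι₁ := ContinuousLinearMap.inl ℝ E E
  set ι₂ := ContinuousLinearMap.inr ℝ E E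
  let π₁ := ContinuousLinearMap.fst ℝ E E
  let π₂ := ContinuousLinearMap.snd ℝ E E
  let ℓ : E × E →L[ℝ] ℝ := -(ξ₀.comp π₁ + η₀.comp π₂)
  -- Removing the first and second order parts leaves a function with a strict quadratic maximum at
  -- the origin.
  let w : E × E → ℝ := fun z => U (x₀ + π₁ z) + W (y₀ + π₂ z) + ℓ z + -T z z
  have hw : Continuous w := by fun_prop
  have hwK : HasLowerParaboloids (K + K + 0 + ‖T‖) w :=
    (((hUK.comp_add_clm hK x₀ π₁ norm_fst_le).add (hWK.comp_add_clm hK y₀ π₂ norm_snd_le)).add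
      (HasLowerParaboloids.clm ℓ)).add (HasLowerParaboloids.neg_bilin T)
  obtain ⟨ρ, hρ, hρmax⟩ := Metric.eventually_nhds_iff_ball.1 hmax
  obtain ⟨t, ht, htτ⟩ : ∃ t, 0 < t ∧ (1 + 2 * ‖T‖) * t ≤ τ ∧ t ≤ τ := by
    refine ⟨τ / (1 + 2 * ‖T‖), by positivity, le_of_eq (by field_simp), ?_⟩
    exact div_le_self hτ.le (by linarith [norm_nonneg T])
  obtain ⟨z, hz, p, D, hp, hexp, hzmax⟩ := exists_second_order_expansion (z₀ := 0) (ρ := ρ / 2)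
    (ε := 1) hw (by positivity) hwK one_pos (half_pos hρ) (by
      intro z hz
      have h1 := hρmax z (closedBall_subset_ball (half_lt_self hρ) hz)
      simp only [w, ℓ, π₁, π₂]
      simp
      linarith) ht
  rw [mem_ball_zero_iff] at hz
  -- Besides `p`, the jets pick up the derivative at `z` of the subtracted quadratic form.
  let q : E × E →L[ℝ] ℝ := p + (T z + T.flip z)
  have hq : ‖q‖ ≤ τ := by
    refine (norm_add_le _ _).trans ?_
    have h1 : ‖T z + T.flip z‖ ≤ ‖T‖ * ‖z‖ + ‖T‖ * ‖z‖ := by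
      refine (norm_add_le _ _).trans (add_le_add (T.le_opNorm z) ?_)
      exact (T.flip.le_opNorm z).trans (by rw [ContinuousLinearMap.opNorm_flip])
    have h2 : ‖T‖ * ‖z‖ ≤ ‖T‖ * t := by gcongr
    linarith
  have hqι₁ : ‖q.comp ι₁‖ ≤ τ :=
    (q.opNorm_comp_le ι₁).trans ((mul_le_of_le_one_right (norm_nonneg _)
      (ContinuousLinearMap.norm_inl_le_one ℝ E E)).trans hq)
  have hqι₂ : ‖q.comp ι₂‖ ≤ τ :=
    (q.opNorm_comp_le ι₂).trans ((mul_le_of_le_one_right (norm_nonneg _)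
      (ContinuousLinearMap.norm_inr_le_one ℝ E E)).trans hq)
  have ht₁ : Tendsto ι₁ (𝓝 0) (𝓝 0) := by simpa using ι₁.continuous.tendsto 0
  have ht₂ : Tendsto ι₂ (𝓝 0) (𝓝 0) := by simpa using ι₂.continuous.tendsto 0
  refine ⟨x₀ + z.1, ?_, y₀ + z.2, ?_, ξ₀ + q.comp ι₁, η₀ + q.comp ι₂,
    (D + (2 : ℝ) • T).bilinearComp ι₁ ι₁, (D + (2 : ℝ) • T).bilinearComp ι₂ ι₂, ?_, ?_, ?_, ?_, ?_⟩
  · simpa using ((norm_fst_le z).trans_lt hz).trans_le htτ.2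
  · simpa using ((norm_snd_le z).trans_lt hz).trans_le htτ.2
  · simpa using hqι₁
  · simpa using hqι₂
  · intro e he
    filter_upwards [ht₁.eventually (hexp e he)] with h hh
    have h1 := (abs_le.1 hh).2
    have h2 : ‖ι₁ h‖ = ‖h‖ := by simp [ι₁, Prod.norm_def]
    rw [h2] at h1
    have h3 : w (z + ι₁ h) = U (x₀ + z.1 + h) + W (y₀ + z.2) - ξ₀ (z.1 + h) - η₀ z.2 -
        T (z + ι₁ h) (z + ι₁ h) := by
      simp [w, ℓ, π₁, π₂, ι₁, add_assoc]; ring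
    have h4 : w z = U (x₀ + z.1) + W (y₀ + z.2) - ξ₀ z.1 - η₀ z.2 - T z z := by
      simp [w, ℓ, π₁, π₂]; ring
    rw [h3, h4] at h1
    simp only [map_add, _root_.add_apply] at h1
    simp only [q, ContinuousLinearMap.comp_apply, ContinuousLinearMap.bilinearComp_apply,
      _root_.add_apply, _root_.smul_apply, ContinuousLinearMap.flip_apply, smul_eq_mul]
    linarith
  · intro e he
    filter_upwards [ht₂.eventually (hexp e he)] with h hh
    have h1 := (abs_le.1 hh).2
    have h2 : ‖ι₂ h‖ = ‖h‖ := by simp [ι₂, Prod.norm_def]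
    rw [h2] at h1
    have h3 : w (z + ι₂ h) = U (x₀ + z.1) + W (y₀ + z.2 + h) - ξ₀ z.1 - η₀ (z.2 + h) -
        T (z + ι₂ h) (z + ι₂ h) := by
      simp [w, ℓ, π₁, π₂, ι₂, add_assoc]; ring
    have h4 : w z = U (x₀ + z.1) + W (y₀ + z.2) - ξ₀ z.1 - η₀ z.2 - T z z := by
      simp [w, ℓ, π₁, π₂]; ring
    rw [h3, h4] at h1
    simp only [map_add, _root_.add_apply] at h1
    simp only [q, ContinuousLinearMap.comp_apply, ContinuousLinearMap.bilinearComp_apply,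
      _root_.add_apply, _root_.smul_apply, ContinuousLinearMap.flip_apply, smul_eq_mul]
    linarith
  · intro a b
    have key : ∀ e > 0, D (ι₁ a) (ι₁ a) + 2 * T (ι₁ a) (ι₁ a) +
        (D (ι₂ b) (ι₂ b) + 2 * T (ι₂ b) (ι₂ b)) - 2 * T (a, b) (a, b) ≤
        2 * e * (‖a‖ ^ 2 + ‖b‖ ^ 2) := by
      intro e he
      have hs : ∀ v : E × E, Tendsto (fun t : ℝ => t • v) (𝓝[>] 0) (𝓝 0) := fun v => by
        have : Tendsto (fun t : ℝ => t • v) (𝓝 0) (𝓝 ((0 : ℝ) • v)) :=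
          (by fun_prop : Continuous fun t : ℝ => t • v).tendsto 0
        rw [zero_smul] at this
        exact this.mono_left nhdsWithin_le_nhds
      obtain ⟨t, ⟨⟨ht1, ht2⟩, ht3⟩, ht0⟩ := ((((hs (ι₁ a)).eventually (hexp e he)).and
        ((hs (ι₂ b)).eventually (hexp e he))).and ((hs (a, b)).eventually hzmax)).and
        self_mem_nhdsWithin |>.exists
      have ht0 : 0 < t := ht0
      have h1 := (abs_le.1 ht1).1
      have h2 := (abs_le.1 ht2).1
      have hab : (a, b) = ι₁ a + ι₂ b := by simp [ι₁, ι₂]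
      have hn1 : ‖ι₁ a‖ = ‖a‖ := by simp [ι₁, Prod.norm_def]
      have hn2 : ‖ι₂ b‖ = ‖b‖ := by simp [ι₂, Prod.norm_def]
      -- Apart from the cross terms of `T`, `w` splits as a sum over the two factors. So the
      -- expansion is used only along each factor, and the touching affine function is used along
      -- `(a, b)`.
      have h3 : w (z + t • (a, b)) = w (z + t • ι₁ a) + w (z + t • ι₂ b) - w z -
          t ^ 2 * (T (ι₁ a) (ι₂ b) + T (ι₂ b) (ι₁ a)) := by
        have e1 : w (z + t • (a, b)) = U (x₀ + (z.1 + t • a)) + W (y₀ + (z.2 + t • b)) -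
            ξ₀ (z.1 + t • a) - η₀ (z.2 + t • b) - T (z + t • (a, b)) (z + t • (a, b)) := by
          simp [w, ℓ, π₁, π₂]; ring
        have e2 : w (z + t • ι₁ a) = U (x₀ + (z.1 + t • a)) + W (y₀ + z.2) -
            ξ₀ (z.1 + t • a) - η₀ z.2 - T (z + t • ι₁ a) (z + t • ι₁ a) := by
          simp [w, ℓ, π₁, π₂, ι₁]; ring
        have e3 : w (z + t • ι₂ b) = U (x₀ + z.1) + W (y₀ + (z.2 + t • b)) -
            ξ₀ z.1 - η₀ (z.2 + t • b) - T (z + t • ι₂ b) (z + t • ι₂ b) := by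
          simp [w, ℓ, π₁, π₂, ι₂]; ring
        have e4 : w z = U (x₀ + z.1) + W (y₀ + z.2) - ξ₀ z.1 - η₀ z.2 - T z z := by
          simp [w, ℓ, π₁, π₂]; ring
        rw [e1, e2, e3, e4, hab]
        simp only [map_add, map_smul, _root_.add_apply, _root_.smul_apply, smul_eq_mul]
        ring
      rw [h3, hab] at ht3
      simp only [map_add, map_smul, norm_smul, _root_.smul_apply, smul_eq_mul, mul_pow,
        Real.norm_eq_abs, sq_abs, hn1, hn2] at h1 h2 ht3
      rw [hab]
      simp only [map_add, _root_.add_apply]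
      have ht2 : 0 < t ^ 2 := by positivity
      refine le_of_mul_le_mul_left ?_ ht2
      linarith
    have h0 : Tendsto (fun e : ℝ => 2 * e * (‖a‖ ^ 2 + ‖b‖ ^ 2)) (𝓝[>] 0)
        (𝓝 (2 * 0 * (‖a‖ ^ 2 + ‖b‖ ^ 2))) :=
      ((by fun_prop : Continuous fun e : ℝ => 2 * e * (‖a‖ ^ 2 + ‖b‖ ^ 2)).tendsto 0).mono_left
        nhdsWithin_le_nhds
    have h1 := ge_of_tendsto h0 (by
      filter_upwards [self_mem_nhdsWithin] with e he using key e he)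
    simp only [ContinuousLinearMap.bilinearComp_apply, _root_.add_apply, _root_.smul_apply,
      smul_eq_mul]
    linarith

end Doubling

/-! ### Superjets, and viscosity inequalities expressed through them. -/

section Extremal

open Filter Topology

theorem IsUpperJet.congr_shift {E : Type*} [NormedAddCommGroup E] [NormedSpace ℝ E] {v w : E → ℝ}
    {x z : E} {ξ : E →L[ℝ] ℝ} {X : E →L[ℝ] E →L[ℝ] ℝ} (hw : IsUpperJet w x ξ X)
    (h : ∀ᶠ k in 𝓝 (0 : E), v (z + k) - v z ≤ w (x + k) - w x) : IsUpperJet v z ξ X := by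
  intro e he
  filter_upwards [h, hw e he] with k h1 h2
  linarith

theorem IsUpperJet.of_scaling {E : Type*} [NormedAddCommGroup E] [NormedSpace ℝ E] {u : E → ℝ}
    {x₀ y : E} {r M : ℝ} (hr : 0 < r) (hM : 0 < M) {ξ : E →L[ℝ] ℝ} {X : E →L[ℝ] E →L[ℝ] ℝ}
    (h : IsUpperJet (fun y => u (x₀ + r • y) / M) y ξ X) :
    IsUpperJet u (x₀ + r • y) ((M / r) • ξ) ((M / r ^ 2) • X) := by
  intro e he
  have ht : Tendsto (fun k : E => r⁻¹ • k) (𝓝 0) (𝓝 0) := by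
    have : Tendsto (fun k : E => r⁻¹ • k) (𝓝 0) (𝓝 (r⁻¹ • (0 : E))) :=
      (by fun_prop : Continuous fun k : E => r⁻¹ • k).tendsto 0
    rwa [smul_zero] at this
  filter_upwards [ht.eventually (h (e * r ^ 2 / M) (by positivity))] with k hk
  have h1 : x₀ + r • (y + r⁻¹ • k) = x₀ + r • y + k := by
    rw [smul_add, smul_inv_smul₀ hr.ne', add_assoc]
  rw [h1, div_le_iff₀ hM] at hk
  refine hk.trans (le_of_eq ?_)
  simp only [map_smul, _root_.smul_apply, smul_eq_mul, norm_smul, norm_inv,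
    Real.norm_of_nonneg hr.le]
  field_simp

section QuadraticTest

variable {n : ℕ}

local notation "𝔼" => EuclideanSpace ℝ (Fin n)

/-- The inner product as a real bilinear form. -/
noncomputable def innerForm (E : Type*) [NormedAddCommGroup E] [InnerProductSpace ℝ E] :
    E →L[ℝ] E →L[ℝ] ℝ := innerSL ℝ

theorem innerForm_apply {E : Type*} [NormedAddCommGroup E] [InnerProductSpace ℝ E] (x y : E) :
    innerForm E x y = inner ℝ x y := rfl

theorem innerForm_self {E : Type*} [NormedAddCommGroup E] [InnerProductSpace ℝ E] (x : E) :
    innerForm E x x = ‖x‖ ^ 2 := real_inner_self_eq_norm_sq x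

/-- The quadratic polynomial with first and second order parts `ξ`, `X` at `x`. -/
noncomputable def quadraticTest (x ξ : 𝔼) (X : 𝔼 →L[ℝ] 𝔼 →L[ℝ] ℝ) (z : 𝔼) : ℝ :=
  innerSL ℝ ξ (z - x) + 1 / 2 * X (z - x) (z - x)

theorem contDiff_quadraticTest (x ξ : 𝔼) (X : 𝔼 →L[ℝ] 𝔼 →L[ℝ] ℝ) :
    ContDiff ℝ 2 (quadraticTest x ξ X) := by
  unfold quadraticTest
  fun_prop

theorem hasFDerivAt_quadraticTest (x ξ : 𝔼) (X : 𝔼 →L[ℝ] 𝔼 →L[ℝ] ℝ) (z : 𝔼) :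
    HasFDerivAt (quadraticTest x ξ X)
      (innerSL ℝ ξ + (1 / 2 : ℝ) • (X + X.flip) (z - x)) z := by
  have h0 : HasFDerivAt (fun z : 𝔼 => z - x) (ContinuousLinearMap.id ℝ 𝔼) z :=
    (hasFDerivAt_id z).sub_const x
  have h1 := (innerSL ℝ ξ).hasFDerivAt.comp z h0
  have h2 := (X.hasFDerivAt.comp z h0).clm_apply h0
  refine (h1.add (h2.const_mul (1 / 2))).congr_fderiv ?_
  ext v
  simp

theorem fderiv_quadraticTest (x ξ : 𝔼) (X : 𝔼 →L[ℝ] 𝔼 →L[ℝ] ℝ) :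
    fderiv ℝ (quadraticTest x ξ X) = fun z => innerSL ℝ ξ + (1 / 2 : ℝ) • (X + X.flip) (z - x) :=
  funext fun z => (hasFDerivAt_quadraticTest x ξ X z).fderiv

theorem gradient_quadraticTest (x ξ : 𝔼) (X : 𝔼 →L[ℝ] 𝔼 →L[ℝ] ℝ) :
    gradient (quadraticTest x ξ X) x = ξ := by
  refine HasGradientAt.gradient ?_
  rw [hasGradientAt_iff_hasFDerivAt]
  refine (hasFDerivAt_quadraticTest x ξ X x).congr_fderiv ?_
  ext v
  simp

theorem fderiv_fderiv_quadraticTest (x ξ : 𝔼) (X : 𝔼 →L[ℝ] 𝔼 →L[ℝ] ℝ) (v : 𝔼) :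
    fderiv ℝ (fderiv ℝ (quadraticTest x ξ X)) x v v = X v v := by
  have h0 : HasFDerivAt (fun z : 𝔼 => z - x) (ContinuousLinearMap.id ℝ 𝔼) x :=
    (hasFDerivAt_id x).sub_const x
  have h1 : HasFDerivAt (fderiv ℝ (quadraticTest x ξ X))
      ((1 / 2 : ℝ) • ((X + X.flip).comp (ContinuousLinearMap.id ℝ 𝔼))) x := by
    rw [fderiv_quadraticTest]
    exact (((X + X.flip).hasFDerivAt.comp x h0).const_smul (1 / 2 : ℝ)).const_add _
  rw [h1.fderiv]
  simp only [ContinuousLinearMap.comp_id, _root_.smul_apply, _root_.add_apply,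
    ContinuousLinearMap.flip_apply, smul_eq_mul]
  ring

theorem laplacian_quadraticTest (x ξ : 𝔼) (X : 𝔼 →L[ℝ] 𝔼 →L[ℝ] ℝ)
    (b : OrthonormalBasis (Fin n) ℝ 𝔼) :
    Laplacian.laplacian (quadraticTest x ξ X) x = ∑ i, X (b i) (b i) := by
  rw [InnerProductSpace.laplacian_eq_iteratedFDeriv_orthonormalBasis _ b]
  refine Finset.sum_congr rfl fun i _ => ?_
  rw [iteratedFDeriv_two_apply]
  exact fderiv_fderiv_quadraticTest x ξ X (b i)

theorem normalizedPLaplacian_quadraticTest (p : ℝ) (x ξ : 𝔼) (X : 𝔼 →L[ℝ] 𝔼 →L[ℝ] ℝ)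
    (b : OrthonormalBasis (Fin n) ℝ 𝔼) :
    normalizedPLaplacian p (quadraticTest x ξ X) x =
      ∑ i, X (b i) (b i) + (p - 2) * X (‖ξ‖⁻¹ • ξ) (‖ξ‖⁻¹ • ξ) := by
  rw [normalizedPLaplacian, laplacian_quadraticTest x ξ X b, gradient_quadraticTest, hessianForm,
    fderiv_fderiv_quadraticTest]

/-- The normalized `p`-Laplace operator on a gradient `ξ` and a Hessian `X`, computed in `b`. -/
noncomputable def jetPLaplacian (p : ℝ) (b : OrthonormalBasis (Fin n) ℝ 𝔼) (ξ : 𝔼)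
    (X : 𝔼 →L[ℝ] 𝔼 →L[ℝ] ℝ) : ℝ :=
  ∑ i, X (b i) (b i) + (p - 2) * X (‖ξ‖⁻¹ • ξ) (‖ξ‖⁻¹ • ξ)

theorem jetPLaplacian_smul (p : ℝ) (b : OrthonormalBasis (Fin n) ℝ 𝔼) {s : ℝ} (hs : 0 < s) (t : ℝ)
    (ξ : 𝔼) (X : 𝔼 →L[ℝ] 𝔼 →L[ℝ] ℝ) :
    jetPLaplacian p b (s • ξ) (t • X) = t * jetPLaplacian p b ξ X := by
  have : ‖s • ξ‖⁻¹ • s • ξ = ‖ξ‖⁻¹ • ξ := by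
    rw [norm_smul, Real.norm_of_nonneg hs.le, smul_smul, mul_inv_rev, mul_assoc,
      inv_mul_cancel₀ hs.ne', mul_one]
  simp only [jetPLaplacian, this, _root_.smul_apply, smul_eq_mul, mul_add, Finset.mul_sum]
  ring

theorem jetPLaplacian_neg (p : ℝ) (b : OrthonormalBasis (Fin n) ℝ 𝔼)
    (ξ : 𝔼) (X : 𝔼 →L[ℝ] 𝔼 →L[ℝ] ℝ) :
    jetPLaplacian p b (-ξ) (-X) = -jetPLaplacian p b ξ X := by
  simp [jetPLaplacian]
  ring

theorem jetPLaplacian_add_inner (p : ℝ) (b : OrthonormalBasis (Fin n) ℝ 𝔼) {ξ : 𝔼} (hξ : ξ ≠ 0)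
    (X : 𝔼 →L[ℝ] 𝔼 →L[ℝ] ℝ) (e : ℝ) :
    jetPLaplacian p b ξ (X + e • innerForm 𝔼) = jetPLaplacian p b ξ X + e * (n + p - 2) := by
  have h1 : ‖‖ξ‖⁻¹ • ξ‖ = 1 := by
    rw [norm_smul, norm_inv, norm_norm, inv_mul_cancel₀ (norm_ne_zero_iff.2 hξ)]
  simp only [jetPLaplacian, _root_.add_apply, _root_.smul_apply, smul_eq_mul,
    innerForm_self, h1, b.orthonormal.1, Finset.sum_add_distrib]
  simp
  ring

theorem quadraticTest_add_inner (x ξ : 𝔼) (X : 𝔼 →L[ℝ] 𝔼 →L[ℝ] ℝ) (e : ℝ) (h : 𝔼) :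
    quadraticTest x ξ (X + (2 * e) • innerForm 𝔼) (x + h) =
      innerSL ℝ ξ h + 1 / 2 * X h h + e * ‖h‖ ^ 2 := by
  simp [quadraticTest, innerForm_self]
  ring

theorem eventually_nhds_of_add {E : Type*} [NormedAddCommGroup E] {P : E → Prop} {x : E}
    (h : ∀ᶠ k in 𝓝 (0 : E), P (x + k)) : ∀ᶠ z in 𝓝 x, P z := by
  have ht : Tendsto (fun z => z - x) (𝓝 x) (𝓝 0) := by
    have := (by fun_prop : Continuous fun z : E => z - x).tendsto x
    rwa [sub_self] at this
  filter_upwards [ht.eventually h] with z hz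
  rwa [add_sub_cancel] at hz

theorem quadraticTest_self (x ξ : 𝔼) (X : 𝔼 →L[ℝ] 𝔼 →L[ℝ] ℝ) : quadraticTest x ξ X x = 0 := by
  simp [quadraticTest]

theorem le_of_forall_pos_le_add_mul {a b c : ℝ} (h : ∀ e > 0, a ≤ b + e * c) : a ≤ b := by
  have h0 : Tendsto (fun e : ℝ => b + e * c) (𝓝[>] 0) (𝓝 (b + 0 * c)) :=
    ((by fun_prop : Continuous fun e : ℝ => b + e * c).tendsto 0).mono_left nhdsWithin_le_nhds
  rw [zero_mul, add_zero] at h0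
  exact ge_of_tendsto h0 (by filter_upwards [self_mem_nhdsWithin] with e he using h e he)

/-- The quadratic polynomial with Hessian form `X + 2 e I` touches from above; the excess tends to
zero with `e`. The form `X` may be non-symmetric, as only its diagonal values enter. -/
theorem IsViscositySubsolution.le_of_isUpperJet {p θ : ℝ} {H : 𝔼 → 𝔼 → ℝ} {f₀ : 𝔼 → ℝ → ℝ}
    {Ω : Set 𝔼} {u : 𝔼 → ℝ} (hu : IsViscositySubsolution p θ H f₀ Ω u) {x : 𝔼} (hx : x ∈ Ω)
    {ξ : 𝔼} (hξ : ξ ≠ 0) {X : 𝔼 →L[ℝ] 𝔼 →L[ℝ] ℝ} (hX : IsUpperJet u x (innerSL ℝ ξ) X)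
    (b : OrthonormalBasis (Fin n) ℝ 𝔼) :
    f₀ x (u x) ≤ ‖ξ‖ ^ θ * jetPLaplacian p b ξ X + H ξ x := by
  refine le_of_forall_pos_le_add_mul (c := ‖ξ‖ ^ θ * (2 * (n + p - 2))) fun e he => ?_
  let φ := quadraticTest x ξ (X + (2 * e) • innerForm 𝔼)
  have h1 := (hu φ (contDiff_quadraticTest _ _ _).contDiffOn x hx (by
    refine eventually_nhds_of_add ?_
    filter_upwards [hX e he] with h hh
    simp only [φ, quadraticTest_add_inner, quadraticTest_self]
    linarith)).1
  simp only [φ, gradient_quadraticTest, normalizedPLaplacian_quadraticTest p x ξ _ b] at h1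
  have h2 := h1 hξ
  rw [← jetPLaplacian, jetPLaplacian_add_inner p b hξ] at h2
  linarith

/-- A superjet of `-u` is the opposite of a subjet of `u`, and `jetPLaplacian` is odd in the pair
(gradient, Hessian). This puts both halves of the equation in the same form. -/
theorem IsViscositySupersolution.le_of_isUpperJet_neg {p θ : ℝ} {H : 𝔼 → 𝔼 → ℝ} {f₀ : 𝔼 → ℝ → ℝ}
    {Ω : Set 𝔼} {u : 𝔼 → ℝ} (hu : IsViscositySupersolution p θ H f₀ Ω u) {x : 𝔼} (hx : x ∈ Ω)
    {ξ : 𝔼} (hξ : ξ ≠ 0) {X : 𝔼 →L[ℝ] 𝔼 →L[ℝ] ℝ}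
    (hX : IsUpperJet (fun z => -u z) x (innerSL ℝ ξ) X) (b : OrthonormalBasis (Fin n) ℝ 𝔼) :
    H (-ξ) x - f₀ x (u x) ≤ ‖ξ‖ ^ θ * jetPLaplacian p b ξ X := by
  refine le_of_forall_pos_le_add_mul (c := ‖ξ‖ ^ θ * (2 * (n + p - 2))) fun e he => ?_
  let φ := quadraticTest x (-ξ) (-(X + (2 * e) • innerForm 𝔼))
  have hφ : ∀ z, φ z = -quadraticTest x ξ (X + (2 * e) • innerForm 𝔼) z := by
    intro z
    simp only [φ, quadraticTest, map_neg, _root_.neg_apply]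
    ring
  have h1 := (hu φ (contDiff_quadraticTest _ _ _).contDiffOn x hx (by
    refine eventually_nhds_of_add ?_
    filter_upwards [hX e he] with h hh
    simp only [hφ, quadraticTest_add_inner, quadraticTest_self]
    linarith)).1
  simp only [φ, gradient_quadraticTest, normalizedPLaplacian_quadraticTest p x (-ξ) _ b] at h1
  have h2 := h1 (neg_ne_zero.2 hξ)
  rw [← jetPLaplacian, jetPLaplacian_neg, jetPLaplacian_add_inner p b hξ, norm_neg] at h2
  linarith

/-- Subsolutions of the extremal equation
`|∇v|^θ Δ_p^N v + δ (|∇v|^(1 + θ) + |∇v|^σ + 1) = 0` in `Ω`, tested where `∇v ≠ 0`. -/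
def IsExtremalSubsolution (p θ σ δ : ℝ) (Ω : Set 𝔼) (v : 𝔼 → ℝ) : Prop :=
  ∀ x ∈ Ω, ∀ ξ : 𝔼, ξ ≠ 0 → ∀ X : 𝔼 →L[ℝ] 𝔼 →L[ℝ] ℝ, IsUpperJet v x (innerSL ℝ ξ) X →
    ∀ b : OrthonormalBasis (Fin n) ℝ 𝔼,
      -(δ * (‖ξ‖ ^ (1 + θ) + ‖ξ‖ ^ σ + 1)) ≤ ‖ξ‖ ^ θ * jetPLaplacian p b ξ X

/-! ### Sup-convolutions. -/

/-- The supremal convolution of `v` over `K`. -/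
noncomputable def supConvolution (κ : ℝ) (K : Set 𝔼) (v : 𝔼 → ℝ) (x : 𝔼) : ℝ :=
  sSup ((fun z => v z - κ * ‖x - z‖ ^ 2) '' K)

variable {κ : ℝ} {K : Set (EuclideanSpace ℝ (Fin n))} {v : EuclideanSpace ℝ (Fin n) → ℝ}

theorem exists_supConvolution_eq (hK : IsCompact K) (hK' : K.Nonempty) (hv : ContinuousOn v K)
    (x : 𝔼) : ∃ z ∈ K, supConvolution κ K v x = v z - κ * ‖x - z‖ ^ 2 :=
  hK.exists_sSup_image_eq hK' (by fun_prop)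

theorem le_supConvolution (hK : IsCompact K) (hv : ContinuousOn v K) (x : 𝔼) {z : 𝔼} (hz : z ∈ K) :
    v z - κ * ‖x - z‖ ^ 2 ≤ supConvolution κ K v x :=
  le_csSup (hK.image_of_continuousOn (by fun_prop)).bddAbove (mem_image_of_mem _ hz)

theorem le_supConvolution_self (hK : IsCompact K) (hv : ContinuousOn v K) {x : 𝔼} (hx : x ∈ K) :
    v x ≤ supConvolution κ K v x := by
  simpa using le_supConvolution (κ := κ) hK hv x hx

theorem supConvolution_le (hK : IsCompact K) (hK' : K.Nonempty) (hv : ContinuousOn v K)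
    (hκ : 0 ≤ κ) {M : ℝ} (hM : ∀ z ∈ K, v z ≤ M) (x : 𝔼) : supConvolution κ K v x ≤ M := by
  obtain ⟨z, hz, hzx⟩ := exists_supConvolution_eq (κ := κ) hK hK' hv x
  rw [hzx]
  have := hM z hz
  have : 0 ≤ κ * ‖x - z‖ ^ 2 := by positivity
  linarith

theorem norm_sub_sq_identity {E : Type*} [NormedAddCommGroup E] [InnerProductSpace ℝ E]
    (x x' z : E) : ‖x' - z‖ ^ 2 = ‖x - z‖ ^ 2 + 2 * inner ℝ (x - z) (x' - x) + ‖x' - x‖ ^ 2 := by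
  rw [show x' - z = (x - z) + (x' - x) by abel, norm_add_sq_real]

/-- The paraboloid of the supremum that is attained at `x` lies below the whole sup-convolution. -/
theorem hasLowerParaboloids_supConvolution (hK : IsCompact K) (hK' : K.Nonempty)
    (hv : ContinuousOn v K) : HasLowerParaboloids κ (supConvolution κ K v) := by
  intro x
  obtain ⟨z, hz, hzx⟩ := exists_supConvolution_eq (κ := κ) hK hK' hv x
  refine ⟨innerSL ℝ (-(2 * κ) • (x - z)), fun x' => ?_⟩
  have h1 := le_supConvolution (κ := κ) hK hv x' hz
  rw [norm_sub_sq_identity x x' z] at h1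
  rw [hzx, innerSL_apply_apply, real_inner_smul_left]
  linarith

theorem continuous_supConvolution (hK : IsCompact K) (hK' : K.Nonempty)
    (hv : ContinuousOn v K) (hκ : 0 ≤ κ) : Continuous (supConvolution κ K v) := by
  obtain ⟨R, hR⟩ := hK.isBounded.subset_closedBall 0
  have hle : ∀ x x' : 𝔼, supConvolution κ K v x - supConvolution κ K v x' ≤
      κ * (2 * ((‖x‖ + R) * ‖x' - x‖) + ‖x' - x‖ ^ 2) := by
    intro x x'
    obtain ⟨z, hz, hzx⟩ := exists_supConvolution_eq (κ := κ) hK hK' hv x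
    have h1 := le_supConvolution (κ := κ) hK hv x' hz
    rw [norm_sub_sq_identity x x' z] at h1
    have h2 : inner ℝ (x - z) (x' - x) ≤ (‖x‖ + R) * ‖x' - x‖ := by
      refine (real_inner_le_norm _ _).trans ?_
      have := mem_closedBall_zero_iff.1 (hR hz)
      gcongr
      exact (norm_sub_le _ _).trans (by linarith)
    have h3 := mul_le_mul_of_nonneg_left h2 hκ
    rw [hzx]
    linarith
  refine continuous_iff_continuousAt.2 fun x => ?_
  rw [ContinuousAt, tendsto_iff_dist_tendsto_zero]
  have hlim : Tendsto (fun x' : 𝔼 => κ * (2 * ((‖x‖ + ‖x'‖ + R) * ‖x' - x‖) + ‖x' - x‖ ^ 2))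
      (𝓝 x) (𝓝 (κ * (2 * ((‖x‖ + ‖x‖ + R) * ‖x - x‖) + ‖x - x‖ ^ 2))) :=
    (by fun_prop : Continuous fun x' : 𝔼 =>
      κ * (2 * ((‖x‖ + ‖x'‖ + R) * ‖x' - x‖) + ‖x' - x‖ ^ 2)).tendsto x
  simp only [sub_self, norm_zero] at hlim
  norm_num at hlim
  refine squeeze_zero (fun _ => dist_nonneg) (fun x' => ?_) hlim
  rw [Real.dist_eq, abs_sub_le_iff]
  have h1 := hle x x'
  have h2 := hle x' x
  rw [norm_sub_rev x x'] at h2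
  have h3 : 0 ≤ κ * (2 * (‖x‖ * ‖x' - x‖)) := by positivity
  have h4 : 0 ≤ κ * (2 * (‖x'‖ * ‖x' - x‖)) := by positivity
  constructor <;> linarith

theorem exists_supConvolution_eq_near (hK : IsCompact K) (hv : ContinuousOn v K)
    (hosc : ∀ z ∈ K, ∀ z' ∈ K, v z ≤ v z' + 1) {x : 𝔼} (hx : x ∈ K) :
    ∃ z ∈ K, supConvolution κ K v x = v z - κ * ‖x - z‖ ^ 2 ∧ κ * ‖x - z‖ ^ 2 ≤ 1 := by
  obtain ⟨z, hz, hzx⟩ := exists_supConvolution_eq (κ := κ) hK ⟨x, hx⟩ hv x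
  refine ⟨z, hz, hzx, ?_⟩
  have h1 := le_supConvolution_self (κ := κ) hK hv hx
  have h2 := hosc z hz x hx
  linarith

/-- The extremal equation is translation invariant, so a superjet at `x` is also one of `v` at the
point `z` realizing the supremum. As `v` oscillates by at most `1` and `κ ≥ 4`, `z` is within
distance `1` of `x`, hence interior to the larger ball. -/
theorem isExtremalSubsolution_supConvolution {p θ σ δ : ℝ} {x₁ : 𝔼}
    (hv : ContinuousOn v (closedBall x₁ 2))
    (hosc : ∀ z ∈ closedBall x₁ 2, ∀ z' ∈ closedBall x₁ 2, v z ≤ v z' + 1) (hκ : 4 ≤ κ)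
    (hvs : IsExtremalSubsolution p θ σ δ (ball x₁ 2) v) :
    IsExtremalSubsolution p θ σ δ (closedBall x₁ 1) (supConvolution κ (closedBall x₁ 2) v) := by
  intro x hx ξ hξ X hX b
  have hK := isCompact_closedBall x₁ 2
  obtain ⟨z, hz, hzx, hzn⟩ := exists_supConvolution_eq_near (κ := κ) hK hv hosc
    (closedBall_subset_closedBall one_le_two hx)
  have hzn' : ‖x - z‖ < 1 := by
    have : 4 * ‖x - z‖ ^ 2 ≤ 1 := le_trans (by gcongr) hzn
    nlinarith [norm_nonneg (x - z)]
  have hz' : z ∈ ball x₁ 2 := by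
    rw [mem_closedBall, dist_eq_norm] at hx
    rw [mem_ball, dist_eq_norm, show z - x₁ = (x - x₁) - (x - z) by abel]
    exact (norm_sub_le _ _).trans_lt (by linarith)
  refine hvs z hz' ξ hξ X (hX.congr_shift ?_) b
  have ht : Tendsto (fun k => z + k) (𝓝 0) (𝓝 z) := by
    have := (by fun_prop : Continuous fun k : 𝔼 => z + k).tendsto 0
    rwa [add_zero] at this
  filter_upwards [ht.eventually (isOpen_ball.mem_nhds hz')] with k hk
  have h1 := le_supConvolution (κ := κ) hK hv (x + k) (ball_subset_closedBall hk)
  rw [add_sub_add_right_eq_sub] at h1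
  rw [hzx]
  linarith

end QuadraticTest

end Extremal

/-! ### Taylor expansions of radial functions. -/

section Holder

open Filter Topology

/-- The mean value inequality applied to the remainder, whose derivative is at most `e * |s - s₀|`;
thus `g'` need only be differentiable at `s₀`. -/
theorem scalar_taylor_two {g g' : ℝ → ℝ} {g₂ s₀ : ℝ} (hg : ∀ᶠ s in 𝓝 s₀, HasDerivAt g (g' s) s)
    (hg' : HasDerivAt g' g₂ s₀) : ∀ e > 0, ∀ᶠ s in 𝓝 s₀,
      |g s - g s₀ - g' s₀ * (s - s₀) - g₂ / 2 * (s - s₀) ^ 2| ≤ e * (s - s₀) ^ 2 := by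
  intro e he
  have h1 : ∀ᶠ s in 𝓝 s₀, |g' s - g' s₀ - g₂ * (s - s₀)| ≤ e * |s - s₀| := by
    have := hg'.isLittleO.def he
    filter_upwards [this] with s hs
    rw [smul_eq_mul, mul_comm] at hs
    simpa [Real.norm_eq_abs] using hs
  obtain ⟨r, hr, hball⟩ := Metric.eventually_nhds_iff_ball.1 (hg.and h1)
  filter_upwards [ball_mem_nhds s₀ hr] with s hs
  let R : ℝ → ℝ := fun t => g t - g' s₀ * (t - s₀) - g₂ / 2 * (t - s₀) ^ 2
  have hmem : ∀ t ∈ uIcc s₀ s, t ∈ ball s₀ r ∧ |t - s₀| ≤ |s - s₀| := by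
    intro t ht
    have h2 := abs_sub_left_of_mem_uIcc ht
    refine ⟨?_, h2⟩
    rw [mem_ball, Real.dist_eq] at hs ⊢
    exact h2.trans_lt hs
  have h3 := (convex_uIcc s₀ s).norm_image_sub_le_of_norm_hasDerivWithin_le (f := R)
    (f' := fun t => g' t - g' s₀ - g₂ * (t - s₀)) (C := e * |s - s₀|) (fun t ht => by
      have h4 := (hball t (hmem t ht).1).1
      have h5 : HasDerivAt (fun t : ℝ => t - s₀) 1 t := (hasDerivAt_id t).sub_const s₀
      have h6 := (h4.sub (h5.const_mul (g' s₀))).sub ((h5.pow 2).const_mul (g₂ / 2))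
      refine (h6.congr_deriv ?_).hasDerivWithinAt
      simp
      ring) (fun t ht => by
      refine (hball t (hmem t ht).1).2.trans ?_
      exact mul_le_mul_of_nonneg_left (hmem t ht).2 he.le) left_mem_uIcc right_mem_uIcc
  simp only [R, Real.norm_eq_abs] at h3
  have h7 : e * |s - s₀| * |s - s₀| = e * (s - s₀) ^ 2 := by rw [mul_assoc, abs_mul_abs_self]; ring
  rw [h7] at h3
  convert h3 using 2
  ring

/-- Second order expansion of a radial function. -/
theorem radial_taylor_two {E : Type*} [NormedAddCommGroup E] [InnerProductSpace ℝ E] {g : ℝ → ℝ}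
    {g₁ g₂ : ℝ} {a : E} (hg : ∀ e > 0, ∀ᶠ s in 𝓝 (‖a‖ ^ 2),
      |g s - g (‖a‖ ^ 2) - g₁ * (s - ‖a‖ ^ 2) - g₂ / 2 * (s - ‖a‖ ^ 2) ^ 2| ≤
        e * (s - ‖a‖ ^ 2) ^ 2) :
    ∀ e > 0, ∀ᶠ h in 𝓝 (0 : E), |g (‖a + h‖ ^ 2) - g (‖a‖ ^ 2) - 2 * g₁ * inner ℝ a h -
      (g₁ * ‖h‖ ^ 2 + 2 * g₂ * inner ℝ a h ^ 2)| ≤ e * ‖h‖ ^ 2 := by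
  intro e he
  set A := (2 * ‖a‖ + 1) ^ 2 with hA
  have hA0 : 0 < A := by positivity
  have ht : Tendsto (fun h : E => ‖a + h‖ ^ 2) (𝓝 0) (𝓝 (‖a‖ ^ 2)) := by
    have := (by fun_prop : Continuous fun h : E => ‖a + h‖ ^ 2).tendsto 0
    rwa [add_zero] at this
  have hsmall : ∀ᶠ h in 𝓝 (0 : E), |g₂| / 2 * (4 * ‖a‖ + ‖h‖) * ‖h‖ < e / 2 := by
    have := (by fun_prop : Continuous fun h : E =>
      |g₂| / 2 * (4 * ‖a‖ + ‖h‖) * ‖h‖).tendsto 0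
    rw [norm_zero, mul_zero] at this
    exact this.eventually (gt_mem_nhds (half_pos he))
  filter_upwards [ht.eventually (hg (e / (2 * A)) (by positivity)), hsmall,
    ball_mem_nhds (0 : E) one_pos] with h h1 h2 h3
  rw [mem_ball_zero_iff] at h3
  have hs : ‖a + h‖ ^ 2 - ‖a‖ ^ 2 = 2 * inner ℝ a h + ‖h‖ ^ 2 := by rw [norm_add_sq_real]; ring
  rw [hs] at h1
  set t := inner ℝ a h with htdef
  have hta : |t| ≤ ‖a‖ * ‖h‖ := abs_real_inner_le_norm a h
  have hd : |2 * t + ‖h‖ ^ 2| ≤ (2 * ‖a‖ + 1) * ‖h‖ := by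
    refine (abs_add_le _ _).trans ?_
    rw [abs_mul, abs_two, abs_of_nonneg (sq_nonneg ‖h‖)]
    nlinarith [norm_nonneg h]
  have hd2 : (2 * t + ‖h‖ ^ 2) ^ 2 ≤ A * ‖h‖ ^ 2 := by
    rw [← sq_abs, hA, ← mul_pow]
    gcongr
  have h4 : e / (2 * A) * (2 * t + ‖h‖ ^ 2) ^ 2 ≤ e / 2 * ‖h‖ ^ 2 := by
    calc _ ≤ e / (2 * A) * (A * ‖h‖ ^ 2) := by gcongr
      _ = _ := by field_simp
  -- This is the part of `(2 t + ‖h‖ ^ 2) ^ 2` beyond `4 t ^ 2`; it is of third order.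
  have h5 : |g₂ / 2 * ((4 * t + ‖h‖ ^ 2) * ‖h‖ ^ 2)| ≤ e / 2 * ‖h‖ ^ 2 := by
    have h6 : |4 * t + ‖h‖ ^ 2| ≤ (4 * ‖a‖ + ‖h‖) * ‖h‖ := by
      refine (abs_add_le _ _).trans ?_
      rw [abs_mul, abs_of_nonneg (sq_nonneg ‖h‖), abs_of_pos (show (0 : ℝ) < 4 by norm_num)]
      nlinarith
    rw [abs_mul, abs_mul, abs_div, abs_two, abs_of_nonneg (sq_nonneg ‖h‖)]
    calc _ ≤ |g₂| / 2 * ((4 * ‖a‖ + ‖h‖) * ‖h‖ * ‖h‖ ^ 2) := by gcongr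
      _ = |g₂| / 2 * (4 * ‖a‖ + ‖h‖) * ‖h‖ * ‖h‖ ^ 2 := by ring
      _ ≤ _ := by gcongr
  have h6 := abs_le.1 (h1.trans h4)
  have h7 := abs_le.1 h5
  rw [abs_le]
  constructor <;> nlinarith [h6.1, h6.2, h7.1, h7.2]

theorem norm_normalize_sub_le {E : Type*} [NormedAddCommGroup E] [NormedSpace ℝ E] {x y : E}
    (hx : x ≠ 0) (hy : y ≠ 0) : ‖‖x‖⁻¹ • x - ‖y‖⁻¹ • y‖ ≤ 2 * ‖x - y‖ / ‖y‖ := by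
  have hx' : 0 < ‖x‖ := norm_pos_iff.2 hx
  have hy' : 0 < ‖y‖ := norm_pos_iff.2 hy
  have h1 : ‖x‖⁻¹ • x - ‖y‖⁻¹ • y = ‖y‖⁻¹ • (x - y) + (‖x‖⁻¹ - ‖y‖⁻¹) • x := by
    rw [smul_sub, sub_smul]; abel
  rw [h1]
  refine (norm_add_le _ _).trans ?_
  rw [norm_smul, norm_smul, norm_inv, norm_norm, Real.norm_eq_abs]
  have h2 : |‖x‖⁻¹ - ‖y‖⁻¹| * ‖x‖ = |‖y‖ - ‖x‖| / ‖y‖ := by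
    have : ‖x‖⁻¹ - ‖y‖⁻¹ = (‖y‖ - ‖x‖) / (‖x‖ * ‖y‖) := by field_simp
    rw [this, abs_div, abs_of_pos (mul_pos hx' hy')]
    field_simp
  rw [h2]
  have h3 : |‖y‖ - ‖x‖| ≤ ‖x - y‖ := by rw [norm_sub_rev]; exact abs_norm_sub_norm_le y x
  calc _ ≤ ‖y‖⁻¹ * ‖x - y‖ + ‖x - y‖ / ‖y‖ := by gcongr
    _ = _ := by ring

/-! ### Reflection coupling of the two Hessians. -/

section Coupling

variable {n : ℕ}

local notation "𝔼" => EuclideanSpace ℝ (Fin n)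

theorem exists_orthonormalBasis_apply_eq (i₀ : Fin n) {e : 𝔼} (he : ‖e‖ = 1) :
    ∃ b : OrthonormalBasis (Fin n) ℝ 𝔼, b i₀ = e := by
  have h1 : Orthonormal ℝ (({i₀} : Set (Fin n)).domRestrict fun _ => e) := by
    constructor
    · intro i; simpa using he
    · intro i j hij
      exact absurd (Subsingleton.elim i j) hij
  obtain ⟨b, hb⟩ := h1.exists_orthonormalBasis_extension_of_card_eq (by simp)
  exact ⟨b, hb i₀ rfl⟩

/-- Reflection coupling: a pair of orthonormal bases adapted to two nearby directions. -/
theorem exists_reflected_bases (i₀ : Fin n) {e₁ e₂ : 𝔼} (h₁ : ‖e₁‖ = 1) (h₂ : ‖e₂‖ = 1)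
    (hs : 1 ≤ ‖e₁ + e₂‖) :
    ∃ b f : OrthonormalBasis (Fin n) ℝ 𝔼, f i₀ = e₂ ∧ b i₀ = -e₁ ∧
      ∀ i, i ≠ i₀ → ‖b i - f i‖ ≤ 2 * ‖e₁ - e₂‖ := by
  obtain ⟨f, hf⟩ := exists_orthonormalBasis_apply_eq i₀ h₂
  have hu : e₂ - -e₁ = e₁ + e₂ := by abel
  -- The reflection taking `e₂` to `-e₁`. It almost fixes the vectors orthogonal to `e₂`, because
  -- their component along `e₁ + e₂` equals that along `e₁ - e₂`.
  let R : 𝔼 ≃ₗᵢ[ℝ] 𝔼 := (ℝ ∙ (e₂ - -e₁))ᗮ.reflection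
  refine ⟨f.map R, f, hf, ?_, fun i hi => ?_⟩
  · rw [OrthonormalBasis.map_apply, hf]
    exact Submodule.reflection_sub (by rw [norm_neg, h₁, h₂])
  · have h3 : R (f i) - f i = -((2 * (inner ℝ (e₁ + e₂) (f i) / ‖e₁ + e₂‖ ^ 2)) • (e₁ + e₂)) := by
      simp only [R]
      rw [Submodule.reflection_orthogonal_apply, Submodule.reflection_singleton_apply, hu]
      simp only [RCLike.ofReal_real_eq_id, id]
      rw [neg_sub, sub_sub_cancel_left, mul_smul, two_smul, two_smul]
    have h4 : inner ℝ (e₁ + e₂) (f i) = inner ℝ (e₁ - e₂) (f i) := by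
      have h5 : inner ℝ e₂ (f i) = 0 := by
        rw [← hf]; exact f.orthonormal.2 hi.symm
      rw [inner_add_left, inner_sub_left, h5]; ring
    rw [OrthonormalBasis.map_apply, h3, norm_neg, norm_smul, h4, Real.norm_eq_abs, abs_mul, abs_div,
      abs_two, abs_of_nonneg (sq_nonneg ‖e₁ + e₂‖)]
    have h5 : |inner ℝ (e₁ - e₂) (f i)| ≤ ‖e₁ - e₂‖ := by
      refine (abs_real_inner_le_norm _ _).trans ?_
      rw [f.orthonormal.1 i, mul_one]
    have h6 : 2 * (|inner ℝ (e₁ - e₂) (f i)| / ‖e₁ + e₂‖ ^ 2) * ‖e₁ + e₂‖ =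
        2 * (|inner ℝ (e₁ - e₂) (f i)| / ‖e₁ + e₂‖) := by field_simp
    rw [h6]
    gcongr
    exact (div_le_self (abs_nonneg _) hs).trans h5

/-- In a basis containing the gradient direction the operator is diagonal with positive weights, so
Hessian bounds can be summed vector by vector. -/
theorem jetPLaplacian_eq_of_apply_eq {p : ℝ} {b : OrthonormalBasis (Fin n) ℝ 𝔼} {i₀ : Fin n} {ξ : 𝔼}
    (hb : b i₀ = -(‖ξ‖⁻¹ • ξ)) (X : 𝔼 →L[ℝ] 𝔼 →L[ℝ] ℝ) :
    jetPLaplacian p b ξ X =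
      (p - 1) * X (b i₀) (b i₀) + ∑ i ∈ Finset.univ.erase i₀, X (b i) (b i) := by
  have h1 : X (‖ξ‖⁻¹ • ξ) (‖ξ‖⁻¹ • ξ) = X (b i₀) (b i₀) := by rw [hb]; simp
  rw [jetPLaplacian, h1, ← Finset.add_sum_erase _ _ (Finset.mem_univ i₀)]
  ring

/-- The key inequality of the doubling argument, obtained by reflection coupling. -/
theorem jetPLaplacian_add_le {p lam c τ : ℝ} (hp : 1 < p) (hn : 0 < n) (hlam : 0 ≤ lam) (hc : 0 ≤ c)
    (hτ : 0 ≤ τ) (hτ' : τ ≤ 1 / 2) (hτp : τ * (6 * (p - 1) + 16 * n) ≤ p - 1) {ξ η a : 𝔼}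
    (hξ : ξ ≠ 0) (hη : η ≠ 0) (ha : ‖a‖ = 1) (hξa : ‖‖ξ‖⁻¹ • ξ - a‖ ≤ τ)
    (hηa : ‖-(‖η‖⁻¹ • η) - a‖ ≤ τ) {X Y : 𝔼 →L[ℝ] 𝔼 →L[ℝ] ℝ}
    (hXY : ∀ v w, X v v + Y w w ≤
      lam * (‖v - w‖ ^ 2 - 3 / 2 * inner ℝ a (v - w) ^ 2) + c * (‖v‖ ^ 2 + ‖w‖ ^ 2)) :
    ∃ b f : OrthonormalBasis (Fin n) ℝ 𝔼, jetPLaplacian p b ξ X + jetPLaplacian p f η Y ≤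
      -((p - 1) * lam) + 2 * c * (p - 1 + n) := by
  set e₁ := ‖ξ‖⁻¹ • ξ with he₁
  set e₂ := -(‖η‖⁻¹ • η) with he₂
  have h₁ : ‖e₁‖ = 1 := by
    rw [he₁, norm_smul, norm_inv, norm_norm, inv_mul_cancel₀ (norm_ne_zero_iff.2 hξ)]
  have h₂ : ‖e₂‖ = 1 := by
    rw [he₂, norm_neg, norm_smul, norm_inv, norm_norm, inv_mul_cancel₀ (norm_ne_zero_iff.2 hη)]
  have hip : ∀ e : 𝔼, ‖e‖ = 1 → ‖e - a‖ ≤ τ → 1 - τ ^ 2 / 2 ≤ inner ℝ a e := by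
    intro e he hea
    have h3 := norm_sub_sq_real e a
    rw [he, ha, real_inner_comm] at h3
    have h4 : ‖e - a‖ ^ 2 ≤ τ ^ 2 := by gcongr
    linarith
  have hi₁ := hip e₁ h₁ hξa
  have hi₂ := hip e₂ h₂ hηa
  have hsum : 1 ≤ ‖e₁ + e₂‖ := by
    have h3 : inner ℝ a (e₁ + e₂) ≤ ‖e₁ + e₂‖ := by
      refine (real_inner_le_norm _ _).trans ?_
      rw [ha, one_mul]
    rw [inner_add_right] at h3
    nlinarith
  have hdiff : ‖e₁ - e₂‖ ≤ 2 * τ := by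
    have : e₁ - e₂ = (e₁ - a) - (e₂ - a) := by abel
    rw [this]
    exact (norm_sub_le _ _).trans (by linarith)
  obtain ⟨b, f, hf, hb, hbf⟩ := exists_reflected_bases ⟨0, hn⟩ h₁ h₂ hsum
  set i₀ : Fin n := ⟨0, hn⟩
  refine ⟨b, f, ?_⟩
  rw [jetPLaplacian_eq_of_apply_eq hb, jetPLaplacian_eq_of_apply_eq hf]
  -- The opposite signs make the difference `-(e₁ + e₂)` nearly `-2 a`, so the bracket is close to
  -- `4 - (3 / 2) * 4 = -2`: the gain from concavity.
  have hmain : X (b i₀) (b i₀) + Y (f i₀) (f i₀) ≤ lam * (-2 + 6 * τ) + 2 * c := by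
    refine (hXY _ _).trans ?_
    rw [b.orthonormal.1, f.orthonormal.1, hb, hf]
    have h3 : -e₁ - e₂ = -(e₁ + e₂) := by abel
    rw [h3, norm_neg, inner_neg_right, inner_add_right]
    have h4 : ‖e₁ + e₂‖ ≤ 2 := (norm_add_le _ _).trans (by linarith)
    have h5 : ‖e₁ + e₂‖ ^ 2 ≤ 2 ^ 2 := by gcongr
    have h6 : 4 - 4 * τ ≤ (inner ℝ a e₁ + inner ℝ a e₂) ^ 2 := by
      have h7 : 2 - τ ≤ inner ℝ a e₁ + inner ℝ a e₂ := by nlinarith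
      have h8 := pow_le_pow_left₀ (by linarith) h7 2
      nlinarith
    have h7 : ‖e₁ + e₂‖ ^ 2 - 3 / 2 * (-(inner ℝ a e₁ + inner ℝ a e₂)) ^ 2 ≤ -2 + 6 * τ := by
      rw [neg_sq]; linarith
    have h8 := mul_le_mul_of_nonneg_left h7 hlam
    linarith
  -- Here the two vectors nearly coincide, so the large factor `lam` meets only a small number. The
  -- hypothesis `hτp` lets half of the gain absorb all errors in `τ`.
  have hother : ∀ i ∈ Finset.univ.erase i₀, X (b i) (b i) + Y (f i) (f i) ≤
      lam * (16 * τ) + 2 * c := by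
    intro i hi
    refine (hXY _ _).trans ?_
    rw [b.orthonormal.1, f.orthonormal.1]
    have h3 : ‖b i - f i‖ ≤ 4 * τ := (hbf i (Finset.ne_of_mem_erase hi)).trans (by linarith)
    have h4 : ‖b i - f i‖ ^ 2 ≤ (4 * τ) ^ 2 := by gcongr
    have h7 : ‖b i - f i‖ ^ 2 - 3 / 2 * inner ℝ a (b i - f i) ^ 2 ≤ 16 * τ := by
      nlinarith [sq_nonneg (inner ℝ a (b i - f i))]
    have h8 := mul_le_mul_of_nonneg_left h7 hlam
    linarith
  have hsumle : ∑ i ∈ Finset.univ.erase i₀, (X (b i) (b i) + Y (f i) (f i)) ≤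
      n * (lam * (16 * τ) + 2 * c) := by
    refine (Finset.sum_le_card_nsmul _ _ _ hother).trans ?_
    rw [nsmul_eq_mul]
    gcongr
    have := Finset.card_le_univ (Finset.univ.erase i₀)
    rwa [Fintype.card_fin] at this
  rw [Finset.sum_add_distrib] at hsumle
  have h9 := mul_le_mul_of_nonneg_left hmain (show 0 ≤ p - 1 by linarith)
  have h10 := mul_le_mul_of_nonneg_left hτp hlam
  linarith

end Coupling

end Holder

/-! ### The Hölder estimate by doubling of variables. -/

section HolderEstimate

open Filter Topology

/-- Second order data of `s ↦ L s^(1/4)` at `s₀ > 0`. -/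
theorem exists_taylor_quarter_power {L s₀ : ℝ} (hL : 0 < L) (hs₀ : 0 < s₀) :
    ∃ g₁ g₂, 0 < g₁ ∧ g₁ * s₀ = L * s₀ ^ (1 / 4 : ℝ) / 4 ∧ g₂ * s₀ = -(3 / 4) * g₁ ∧
      ∀ e > 0, ∀ᶠ s in 𝓝 s₀, |L * s ^ (1 / 4 : ℝ) - L * s₀ ^ (1 / 4 : ℝ) - g₁ * (s - s₀) -
        g₂ / 2 * (s - s₀) ^ 2| ≤ e * (s - s₀) ^ 2 := by
  refine ⟨L * (1 / 4 * s₀ ^ (1 / 4 - 1 : ℝ)),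
    L * (1 / 4 * ((1 / 4 - 1) * s₀ ^ (1 / 4 - 1 - 1 : ℝ))), by positivity, ?_, ?_, ?_⟩
  · rw [Real.rpow_sub_one hs₀.ne']; field_simp
  · rw [Real.rpow_sub_one hs₀.ne' (1 / 4 - 1)]; field_simp; norm_num
  · refine scalar_taylor_two (g := fun s => L * s ^ (1 / 4 : ℝ))
      (g' := fun s => L * (1 / 4 * s ^ (1 / 4 - 1 : ℝ))) ?_ ?_
    · filter_upwards [lt_mem_nhds hs₀] with s hs
      exact (Real.hasDerivAt_rpow_const (Or.inl hs.ne')).const_mul L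
    · exact (((Real.hasDerivAt_rpow_const (Or.inl hs₀.ne')).const_mul (1 / 4)).const_mul L)

variable {n : ℕ}

local notation "𝔼" => EuclideanSpace ℝ (Fin n)

/-- The quadratic form `(h, k) ↦ g₁ |h - k|² + 2 g₂ ⟨a, h - k⟩² + c (|h|² + |k|²)`. -/
theorem exists_doublingForm (g₁ g₂ c : ℝ) (a : 𝔼) :
    ∃ T : (𝔼 × 𝔼) →L[ℝ] (𝔼 × 𝔼) →L[ℝ] ℝ, ∀ z, T z z =
      g₁ * ‖z.1 - z.2‖ ^ 2 + 2 * g₂ * inner ℝ a (z.1 - z.2) ^ 2 + c * (‖z.1‖ ^ 2 + ‖z.2‖ ^ 2) := by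
  let π₁ := ContinuousLinearMap.fst ℝ 𝔼 𝔼
  let π₂ := ContinuousLinearMap.snd ℝ 𝔼 𝔼
  let A : 𝔼 →L[ℝ] 𝔼 →L[ℝ] ℝ := (innerForm 𝔼 a).smulRight (innerForm 𝔼 a)
  refine ⟨g₁ • (innerForm 𝔼).bilinearComp (π₁ - π₂) (π₁ - π₂) +
    (2 * g₂) • A.bilinearComp (π₁ - π₂) (π₁ - π₂) +
    c • ((innerForm 𝔼).bilinearComp π₁ π₁ + (innerForm 𝔼).bilinearComp π₂ π₂), fun z => ?_⟩
  simp only [_root_.add_apply, _root_.smul_apply, smul_eq_mul,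
    ContinuousLinearMap.bilinearComp_apply, innerForm_self, A, ContinuousLinearMap.smulRight_apply,
    innerForm_apply, π₁, π₂, _root_.sub_apply, ContinuousLinearMap.coe_fst',
    ContinuousLinearMap.coe_snd']
  ring

/-- For slopes at least `1`, each lower order term is at most `‖ξ‖ ^ θ * ‖ξ‖`, so the degenerate
factor cancels. -/
theorem neg_le_jetPLaplacian_of_le_norm {p θ σ δ : ℝ} (hθ : 0 < θ) (hσ' : σ < 1 + θ)
    (hδ1 : δ ≤ 1) {ξ : 𝔼} (hξ : 1 ≤ ‖ξ‖) {b : OrthonormalBasis (Fin n) ℝ 𝔼}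
    {X : 𝔼 →L[ℝ] 𝔼 →L[ℝ] ℝ}
    (h : -(δ * (‖ξ‖ ^ (1 + θ) + ‖ξ‖ ^ σ + 1)) ≤ ‖ξ‖ ^ θ * jetPLaplacian p b ξ X) :
    -(3 * ‖ξ‖) ≤ jetPLaplacian p b ξ X := by
  have h0 : 0 < ‖ξ‖ := by linarith
  have h1 : ‖ξ‖ ^ σ ≤ ‖ξ‖ ^ (1 + θ) := Real.rpow_le_rpow_of_exponent_le hξ hσ'.le
  have h2 : 1 ≤ ‖ξ‖ ^ (1 + θ) := Real.one_le_rpow hξ (by linarith)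
  have h3 : ‖ξ‖ ^ (1 + θ) = ‖ξ‖ ^ θ * ‖ξ‖ := by rw [add_comm, Real.rpow_add_one h0.ne']
  have h4 : δ * (‖ξ‖ ^ (1 + θ) + ‖ξ‖ ^ σ + 1) ≤ 1 * (3 * ‖ξ‖ ^ (1 + θ)) := by
    have : 0 ≤ ‖ξ‖ ^ σ := by positivity
    gcongr
    linarith
  have h5 : 0 < ‖ξ‖ ^ θ := by positivity
  refine le_of_mul_le_mul_left ?_ h5
  rw [h3] at h h4
  linarith

theorem norm_sq_le_add_norm_sq {V W : Type*} [SeminormedAddGroup V] [SeminormedAddGroup W]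
    (z : V × W) : ‖z‖ ^ 2 ≤ ‖z.1‖ ^ 2 + ‖z.2‖ ^ 2 := by
  rw [Prod.norm_def]
  rcases max_choice ‖z.1‖ ‖z.2‖ with h | h <;> rw [h]
  · exact le_add_of_nonneg_right (sq_nonneg _)
  · exact le_add_of_nonneg_left (sq_nonneg _)

theorem norm_sub_sq_le_two_mul {V : Type*} [NormedAddCommGroup V] [InnerProductSpace ℝ V]
    (v w : V) : ‖v - w‖ ^ 2 ≤ 2 * (‖v‖ ^ 2 + ‖w‖ ^ 2) := by
  have h1 := norm_sub_sq_real v w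
  have h2 := norm_add_sq_real v w
  linarith [sq_nonneg ‖v + w‖]

/-- The size of `L` needed in the Hölder estimate. -/
theorem exists_holder_constant {p : ℝ} (hp : 1 < p) (n : ℕ) :
    ∃ L : ℝ, 2 ≤ L ∧ 40 ≤ L ^ 2 ∧ 20 / L ^ 2 * (6 * (p - 1) + 16 * n) ≤ p - 1 ∧
      12 + 24 * (p - 1 + n) < (p - 1) * L ^ 2 := by
  have hp' : 0 < p - 1 := by linarith
  have h1 : Tendsto (fun L : ℝ => L ^ 2) atTop atTop := tendsto_pow_atTop two_ne_zero
  obtain ⟨L, ⟨⟨hL2, h40⟩, hA⟩, hB⟩ := (((eventually_ge_atTop (2 : ℝ)).and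
    (h1.eventually (eventually_ge_atTop 40))).and (h1.eventually
      (eventually_ge_atTop (20 * (6 * (p - 1) + 16 * n) / (p - 1))))).and
      (h1.eventually (eventually_gt_atTop ((12 + 24 * (p - 1 + n)) / (p - 1)))) |>.exists
  refine ⟨L, hL2, h40, ?_, ?_⟩
  · rw [div_le_iff₀ hp'] at hA
    rw [div_mul_eq_mul_div, div_le_iff₀ (by positivity)]
    linarith
  · rw [div_lt_iff₀ hp'] at hB
    linarith

set_option maxHeartbeats 400000 in
/-- The contradiction at an interior maximum point of the doubled function. -/
theorem doubling_contradiction {p θ σ δ L : ℝ} (hn : 0 < n) (hp : 1 < p) (hθ : 0 < θ)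
    (hσ' : σ < 1 + θ) (hδ1 : δ ≤ 1) (hL2 : 2 ≤ L) (hL40 : 40 ≤ L ^ 2)
    (hLτ : 20 / L ^ 2 * (6 * (p - 1) + 16 * n) ≤ p - 1)
    (hLc : 12 + 24 * (p - 1 + n) < (p - 1) * L ^ 2) {κ : ℝ} (hκ : 0 ≤ κ) {U W : 𝔼 → ℝ}
    (hU : Continuous U) (hW : Continuous W) (hUκ : HasLowerParaboloids κ U)
    (hWκ : HasLowerParaboloids κ W) {x₁ : 𝔼}
    (hUs : IsExtremalSubsolution p θ σ δ (closedBall x₁ 1) U)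
    (hWs : IsExtremalSubsolution p θ σ δ (closedBall x₁ 1) W) {x y : 𝔼} (hxy : x ≠ y)
    (hx : ‖x - x₁‖ ≤ 1 / 2) (hy : ‖y - x₁‖ ≤ 3 / 4) (hd : L * (‖x - y‖ ^ 2) ^ (1 / 4 : ℝ) ≤ 1)
    (hmax : ∀ᶠ z in 𝓝 (0 : 𝔼 × 𝔼), U (x + z.1) + W (y + z.2) -
      L * (‖x + z.1 - (y + z.2)‖ ^ 2) ^ (1 / 4 : ℝ) - 4 * ‖x + z.1 - x₁‖ ^ 2 ≤
      U x + W y - L * (‖x - y‖ ^ 2) ^ (1 / 4 : ℝ) - 4 * ‖x - x₁‖ ^ 2) : False := by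
  set a := x - y with ha
  have ha0 : a ≠ 0 := sub_ne_zero.2 hxy
  have hd0 : 0 < ‖a‖ := norm_pos_iff.2 ha0
  obtain ⟨g₁, g₂, hg₁, hg₁s, hg₂, hexp⟩ :=
    exists_taylor_quarter_power (L := L) (by linarith) (pow_pos hd0 2)
  -- The constant is `4 + 1 + 1`: the localization term, the Taylor error (at most `‖z.1‖ ^ 2 +
  -- ‖z.2‖ ^ 2`), and the strictness `‖z‖ ^ 2` required of the maximum.
  obtain ⟨T, hT⟩ := exists_doublingForm g₁ g₂ 6 a
  set ρ := (‖a‖ ^ 2) ^ (1 / 4 : ℝ) with hρ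
  have hρ0 : 0 < ρ := by positivity
  have hdρ : ‖a‖ = ρ ^ 2 := by
    rw [hρ, ← Real.rpow_natCast, ← Real.rpow_natCast, ← Real.rpow_mul hd0.le,
      ← Real.rpow_mul hd0.le]
    norm_num
  -- `Λ` is the slope of the modulus at the contact point
  set Λ := 2 * g₁ * ‖a‖ with hΛ
  have hΛρ : Λ * ρ = L / 2 := by
    have h1 : Λ * ‖a‖ = L * ρ / 2 := by rw [hΛ]; linarith
    rw [hdρ] at h1
    refine mul_right_cancel₀ hρ0.ne' ?_
    linarith
  have hΛL : L ^ 2 / 2 ≤ Λ := by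
    refine le_of_mul_le_mul_right ?_ hρ0
    rw [hΛρ]
    calc L ^ 2 / 2 * ρ = L / 2 * (L * ρ) := by ring
      _ ≤ L / 2 * 1 := by gcongr
      _ = L / 2 := mul_one _
  have hΛ0 : 0 < Λ := by positivity
  -- The points are within `L⁻²` of each other, so the curvature `2 * g₁ = Λ / ‖a‖` exceeds the
  -- slope by the factor `L ^ 2`; this decides the final comparison.
  have hlam : Λ * L ^ 2 ≤ 2 * g₁ := by
    have h1 : L ^ 2 * ‖a‖ ≤ 1 := by
      rw [hdρ, ← mul_pow]
      exact pow_le_one₀ (by positivity) hd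
    rw [hΛ]
    calc 2 * g₁ * ‖a‖ * L ^ 2 = 2 * g₁ * (L ^ 2 * ‖a‖) := by ring
      _ ≤ 2 * g₁ * 1 := by gcongr
      _ = _ := mul_one _
  have hrad := radial_taylor_two (g := fun s => L * s ^ (1 / 4 : ℝ)) (a := a)
    hexp (1 / 2) (by norm_num)
  have ht : Tendsto (fun z : 𝔼 × 𝔼 => z.1 - z.2) (𝓝 0) (𝓝 0) := by
    have := (by fun_prop : Continuous fun z : 𝔼 × 𝔼 => z.1 - z.2).tendsto 0
    simpa using this
  set ξ₀ := (2 * g₁) • a + (8 : ℝ) • (x - x₁) with hξ₀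
  set η₀ := -((2 * g₁) • a) with hη₀
  obtain ⟨x', hx', y', hy', ξ', η', X, Y, hξ', hη', hX, hY, hXY⟩ :=
    exists_jets_of_doubling (x₀ := x) (y₀ := y) (T := T) (ξ₀ := innerSL ℝ ξ₀) (η₀ := innerSL ℝ η₀)
      hκ hU hW hUκ hWκ (by
      filter_upwards [hmax, ht.eventually hrad] with z h1 h2
      have h3 : x + z.1 - (y + z.2) = a + (z.1 - z.2) := by rw [ha]; abel
      rw [h3] at h1
      have h4 := (abs_le.1 h2).2
      have h5 : ‖x + z.1 - x₁‖ ^ 2 = ‖x - x₁‖ ^ 2 + 2 * inner ℝ (x - x₁) z.1 + ‖z.1‖ ^ 2 := by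
        rw [show x + z.1 - x₁ = (x - x₁) + z.1 by abel, norm_add_sq_real]
      have h6 := norm_sq_le_add_norm_sq z
      have h7 := norm_sub_sq_le_two_mul z.1 z.2
      have h8 : innerSL ℝ ξ₀ z.1 + innerSL ℝ η₀ z.2 =
          2 * g₁ * inner ℝ a (z.1 - z.2) + 8 * inner ℝ (x - x₁) z.1 := by
        simp only [hξ₀, hη₀, innerSL_apply_apply, inner_add_left, inner_neg_left,
          real_inner_smul_left, inner_sub_right]
        ring
      rw [hT]
      linarith [sq_nonneg ‖z.2‖]) (show (0 : ℝ) < 1 / 4 by norm_num)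
  set ξ := (InnerProductSpace.toDual ℝ 𝔼).symm ξ' with hξdef
  set η := (InnerProductSpace.toDual ℝ 𝔼).symm η' with hηdef
  have hξe : innerSL ℝ ξ = ξ' := (InnerProductSpace.toDual ℝ 𝔼).apply_symm_apply ξ'
  have hηe : innerSL ℝ η = η' := (InnerProductSpace.toDual ℝ 𝔼).apply_symm_apply η'
  rw [← hξe] at hX hξ'
  rw [← hηe] at hY hη'
  rw [← map_sub, innerSL_apply_norm] at hξ' hη'
  have hqn : ‖(2 * g₁) • a‖ = Λ := by rw [norm_smul, Real.norm_of_nonneg (by positivity)]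
  -- At most `8 * (1 / 2)` from the localization and `1 / 4` from the perturbation of the jet.
  have hξq : ‖ξ - (2 * g₁) • a‖ ≤ 5 := by
    have h1 : ξ - (2 * g₁) • a = (ξ - ξ₀) + (8 : ℝ) • (x - x₁) := by rw [hξ₀]; abel
    rw [h1]
    refine (norm_add_le _ _).trans ?_
    rw [norm_smul, Real.norm_of_nonneg (by norm_num)]
    linarith
  have hηq : ‖-η - (2 * g₁) • a‖ ≤ 5 := by
    have h1 : -η - (2 * g₁) • a = -(η - η₀) := by rw [hη₀]; abel
    rw [h1, norm_neg]
    linarith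
  have hsize : ∀ ζ : 𝔼, ‖ζ - (2 * g₁) • a‖ ≤ 5 → 1 ≤ ‖ζ‖ ∧ ‖ζ‖ ≤ 2 * Λ ∧
      ‖‖ζ‖⁻¹ • ζ - ‖a‖⁻¹ • a‖ ≤ 20 / L ^ 2 := by
    intro ζ hζ
    have h1 := norm_sub_norm_le ζ ((2 * g₁) • a)
    have h2 := norm_sub_norm_le ((2 * g₁) • a) ζ
    rw [norm_sub_rev] at h2
    rw [hqn] at h1 h2
    have h3 : 1 ≤ ‖ζ‖ := by linarith
    refine ⟨h3, by linarith, ?_⟩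
    have h4 : ζ ≠ 0 := norm_pos_iff.1 (by linarith)
    have h5 : (2 * g₁) • a ≠ 0 := norm_pos_iff.1 (by linarith)
    have h6 := norm_normalize_sub_le h4 h5
    have h7 : ‖(2 * g₁) • a‖⁻¹ • (2 * g₁) • a = ‖a‖⁻¹ • a := by
      rw [norm_smul, Real.norm_of_nonneg (by positivity), smul_smul, mul_inv_rev, mul_assoc,
        inv_mul_cancel₀ (by positivity), mul_one]
    rw [h7, hqn] at h6
    refine h6.trans ?_
    calc 2 * ‖ζ - (2 * g₁) • a‖ / Λ ≤ 2 * 5 / (L ^ 2 / 2) := by gcongr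
      _ = 20 / L ^ 2 := by field_simp; norm_num
  obtain ⟨hξ1, hξ2, hξ3⟩ := hsize ξ hξq
  obtain ⟨hη1, hη2, hη3⟩ := hsize (-η) hηq
  rw [norm_neg] at hη1 hη2
  rw [norm_neg, smul_neg] at hη3
  have hξ0 : ξ ≠ 0 := norm_pos_iff.1 (by linarith)
  have hη0 : η ≠ 0 := norm_pos_iff.1 (by linarith)
  obtain ⟨b, f, hbf⟩ := jetPLaplacian_add_le (lam := 2 * g₁) (c := 12) (τ := 20 / L ^ 2)
    (a := ‖a‖⁻¹ • a) (X := X) (Y := Y) hp hn (by positivity) (by norm_num) (by positivity)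
    (by rw [div_le_iff₀ (by positivity)]; linarith) hLτ hξ0 hη0
    (by rw [norm_smul, norm_inv, norm_norm, inv_mul_cancel₀ hd0.ne']) hξ3 hη3 (by
      intro v w
      refine (hXY v w).trans (le_of_eq ?_)
      rw [hT, real_inner_smul_left]
      have h1 : g₂ = -(3 / 4) * g₁ / ‖a‖ ^ 2 := by
        rw [eq_div_iff (by positivity)]; exact hg₂
      rw [h1]
      field_simp
      ring)
  have hmemx : x' ∈ closedBall x₁ 1 := by
    rw [mem_ball, dist_eq_norm] at hx'
    rw [mem_closedBall, dist_eq_norm, show x' - x₁ = (x' - x) + (x - x₁) by abel]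
    exact (norm_add_le _ _).trans (by linarith)
  have hmemy : y' ∈ closedBall x₁ 1 := by
    rw [mem_ball, dist_eq_norm] at hy'
    rw [mem_closedBall, dist_eq_norm, show y' - x₁ = (y' - y) + (y - x₁) by abel]
    exact (norm_add_le _ _).trans (by linarith)
  have h1 := neg_le_jetPLaplacian_of_le_norm hθ hσ' hδ1 hξ1 (hUs x' hmemx ξ hξ0 X hX b)
  have h2 := neg_le_jetPLaplacian_of_le_norm hθ hσ' hδ1 hη1 (hWs y' hmemy η hη0 Y hY f)
  have h3 : (p - 1) * (Λ * L ^ 2) ≤ (p - 1) * (2 * g₁) :=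
    mul_le_mul_of_nonneg_left hlam (by linarith)
  have h4 : (p - 1) * L ^ 2 * Λ ≤ 12 * Λ + 24 * (p - 1 + n) := by linarith
  have h5 : (12 + 24 * (p - 1 + n)) * Λ < (p - 1) * L ^ 2 * Λ := by gcongr
  have h6 : 0 ≤ p - 1 + n := by have : (0 : ℝ) ≤ n := Nat.cast_nonneg n; linarith
  have h7 := mul_le_mul_of_nonneg_left (show 1 ≤ Λ by linarith) h6
  linarith

/-- Regularization of a function and its opposite by supremal convolutions. -/
theorem exists_regularizations {p θ σ δ μ : ℝ} {v : 𝔼 → ℝ} {x₁ : 𝔼} (hμ : 0 < μ)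
    (hv : ContinuousOn v (closedBall x₁ 2)) (hv01 : ∀ z ∈ closedBall x₁ 2, 0 ≤ v z ∧ v z ≤ 1)
    (hvs : IsExtremalSubsolution p θ σ δ (ball x₁ 2) v)
    (hvs' : IsExtremalSubsolution p θ σ δ (ball x₁ 2) (fun z => -v z)) :
    ∃ κ, 0 ≤ κ ∧ ∃ U W : 𝔼 → ℝ, Continuous U ∧ Continuous W ∧ HasLowerParaboloids κ U ∧
      HasLowerParaboloids κ W ∧ IsExtremalSubsolution p θ σ δ (closedBall x₁ 1) U ∧
      IsExtremalSubsolution p θ σ δ (closedBall x₁ 1) W ∧ (∀ x, U x ≤ 1) ∧ (∀ x, W x ≤ 0) ∧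
      (∀ x ∈ closedBall x₁ 1, v x ≤ U x ∧ -v x ≤ W x ∧ U x + W x < μ) := by
  set K := closedBall x₁ 2 with hKdef
  have hK : IsCompact K := isCompact_closedBall x₁ 2
  have hKne : K.Nonempty := nonempty_closedBall.2 zero_le_two
  have h12 : closedBall x₁ 1 ⊆ K := closedBall_subset_closedBall one_le_two
  obtain ⟨d, hd, hdv⟩ := Metric.uniformContinuousOn_iff.1 (hK.uniformContinuousOn_of_continuous hv)
    μ hμ
  obtain ⟨κ, hκ4, hκd⟩ : ∃ κ : ℝ, 4 ≤ κ ∧ 16 / d ^ 2 ≤ κ :=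
    ⟨max 4 (16 / d ^ 2), le_max_left _ _, le_max_right _ _⟩
  have hκ : 0 ≤ κ := by linarith
  have hnv : ContinuousOn (fun z => -v z) K := hv.neg
  set U := supConvolution κ K v with hU
  set W := supConvolution κ K (fun z => -v z) with hW
  have hUc : Continuous U := continuous_supConvolution hK hKne hv hκ
  have hWc : Continuous W := continuous_supConvolution hK hKne hnv hκ
  have hosc : ∀ z ∈ K, ∀ z' ∈ K, v z ≤ v z' + 1 := fun z hz z' hz' => by
    linarith [(hv01 z hz).2, (hv01 z' hz').1]
  have hosc' : ∀ z ∈ K, ∀ z' ∈ K, -v z ≤ -v z' + 1 := fun z hz z' hz' => by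
    linarith [(hv01 z hz).1, (hv01 z' hz').2]
  have hUle : ∀ x, U x ≤ 1 := supConvolution_le hK hKne hv hκ fun z hz => (hv01 z hz).2
  have hWle : ∀ x, W x ≤ 0 := supConvolution_le hK hKne hnv hκ fun z hz => by
    linarith [(hv01 z hz).1]
  refine ⟨κ, hκ, U, W, hUc, hWc, hasLowerParaboloids_supConvolution hK hKne hv,
    hasLowerParaboloids_supConvolution hK hKne hnv,
    isExtremalSubsolution_supConvolution hv hosc hκ4 hvs,
    isExtremalSubsolution_supConvolution hnv hosc' hκ4 hvs', hUle, hWle, fun x hx =>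
    ⟨le_supConvolution_self hK hv (h12 hx), le_supConvolution_self hK hnv (h12 hx), ?_⟩⟩
  obtain ⟨z, hz, hzU, hzn⟩ := exists_supConvolution_eq_near (κ := κ) hK hv hosc (h12 hx)
  obtain ⟨z', hz', hzW, hzn'⟩ := exists_supConvolution_eq_near (κ := κ) hK hnv hosc' (h12 hx)
  -- Both optimal points are so close to `x` that uniform continuity gives `v z - v z' < μ`.
  have hclose : ∀ w : 𝔼, κ * ‖x - w‖ ^ 2 ≤ 1 → ‖x - w‖ ≤ d / 4 := by
    intro w hw
    have h1 : 16 / d ^ 2 * ‖x - w‖ ^ 2 ≤ 1 := le_trans (by gcongr) hw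
    rw [div_mul_eq_mul_div, div_le_one (by positivity)] at h1
    nlinarith [norm_nonneg (x - w)]
  have h1 : dist z z' < d := by
    rw [dist_eq_norm, show z - z' = (x - z') - (x - z) by abel]
    refine (norm_sub_le _ _).trans_lt ?_
    linarith [hclose z hzn, hclose z' hzn']
  have h2 := hdv z hz z' hz' h1
  rw [Real.dist_eq] at h2
  have h3 := le_abs_self (v z - v z')
  have h4 : 0 ≤ κ * ‖x - z‖ ^ 2 := by positivity
  have h5 : 0 ≤ κ * ‖x - z'‖ ^ 2 := by positivity
  have h6 : U x = v z - κ * ‖x - z‖ ^ 2 := hzU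
  have h7 : W x = -v z' - κ * ‖x - z'‖ ^ 2 := hzW
  linarith

/-- Hölder estimate for functions which are subsolutions together with their opposite. -/
theorem exists_holder_estimate {p θ σ : ℝ} (hn : 0 < n) (hp : 1 < p) (hθ : 0 < θ)
    (hσ' : σ < 1 + θ) : ∃ L : ℝ, 0 < L ∧ ∀ (δ : ℝ) (v : 𝔼 → ℝ) (x₁ : 𝔼), δ ≤ 1 →
      ContinuousOn v (closedBall x₁ 2) → (∀ z ∈ closedBall x₁ 2, 0 ≤ v z ∧ v z ≤ 1) →
      IsExtremalSubsolution p θ σ δ (ball x₁ 2) v →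
      IsExtremalSubsolution p θ σ δ (ball x₁ 2) (fun z => -v z) →
      ∀ y ∈ closedBall x₁ 1, v x₁ - v y ≤ L * (‖x₁ - y‖ ^ 2) ^ (1 / 4 : ℝ) := by
  obtain ⟨L, hL2, hL40, hLτ, hLc⟩ := exists_holder_constant hp n
  refine ⟨L, by linarith, fun δ v x₁ hδ1 hv hv01 hvs hvs' y₁ hy₁ => ?_⟩
  by_contra hcon
  push Not at hcon
  obtain ⟨μ, hμ, hμv⟩ : ∃ μ, 0 < μ ∧ μ ≤ v x₁ - v y₁ - L * (‖x₁ - y₁‖ ^ 2) ^ (1 / 4 : ℝ) :=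
    ⟨_, by linarith, le_rfl⟩
  obtain ⟨κ, hκ, U, W, hUc, hWc, hUκ, hWκ, hUs, hWs, hUle, hWle, hUW⟩ :=
    exists_regularizations hμ hv hv01 hvs hvs'
  let Ψ : 𝔼 × 𝔼 → ℝ := fun z =>
    U z.1 + W z.2 - L * (‖z.1 - z.2‖ ^ 2) ^ (1 / 4 : ℝ) - 4 * ‖z.1 - x₁‖ ^ 2
  have hΨ : Continuous Ψ := by
    have : Continuous fun z : 𝔼 × 𝔼 => (‖z.1 - z.2‖ ^ 2) ^ (1 / 4 : ℝ) :=
      (by fun_prop : Continuous fun z : 𝔼 × 𝔼 => ‖z.1 - z.2‖ ^ 2).rpow_const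
        fun _ => Or.inr (by norm_num)
    fun_prop
  have hx₁ : x₁ ∈ closedBall x₁ (1 : ℝ) := mem_closedBall_self zero_le_one
  obtain ⟨⟨x, y⟩, ⟨hx, hy⟩, hmax⟩ := ((isCompact_closedBall x₁ 1).prod
    (isCompact_closedBall x₁ 1)).exists_isMaxOn ⟨(x₁, y₁), hx₁, hy₁⟩ hΨ.continuousOn
  have hΨμ : μ ≤ Ψ (x, y) := by
    have h1 : Ψ (x₁, y₁) ≤ Ψ (x, y) := hmax ⟨hx₁, hy₁⟩
    have h2 : v x₁ ≤ U x₁ := (hUW x₁ hx₁).1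
    have h3 : -v y₁ ≤ W y₁ := (hUW y₁ hy₁).2.1
    have h4 : Ψ (x₁, y₁) = U x₁ + W y₁ - L * (‖x₁ - y₁‖ ^ 2) ^ (1 / 4 : ℝ) := by simp [Ψ]
    linarith
  have hΨxy : Ψ (x, y) =
    U x + W y - L * (‖x - y‖ ^ 2) ^ (1 / 4 : ℝ) - 4 * ‖x - x₁‖ ^ 2 := rfl
  have hterm : 0 ≤ L * (‖x - y‖ ^ 2) ^ (1 / 4 : ℝ) := by positivity
  have hLd : L * (‖x - y‖ ^ 2) ^ (1 / 4 : ℝ) ≤ 1 := by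
    linarith [hUle x, hWle y, sq_nonneg ‖x - x₁‖]
  -- Only `x` is penalized: `y` stays inside the ball because the modulus term forces `‖x - y‖ ≤ 1 /
  -- 4`.
  have hx2 : ‖x - x₁‖ < 1 / 2 := by
    have : 4 * ‖x - x₁‖ ^ 2 < 1 := by linarith [hUle x, hWle y]
    nlinarith [norm_nonneg (x - x₁)]
  have hxyn : ‖x - y‖ ≤ 1 / 4 := by
    set ρ := (‖x - y‖ ^ 2) ^ (1 / 4 : ℝ) with hρ
    have hρ0 : 0 ≤ ρ := by positivity
    have hdρ : ‖x - y‖ = ρ ^ 2 := by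
      rw [hρ, ← Real.rpow_natCast, ← Real.rpow_natCast, ← Real.rpow_mul (norm_nonneg _),
        ← Real.rpow_mul (norm_nonneg _)]
      norm_num
    rw [hdρ]
    have : ρ ≤ 1 / 2 := by nlinarith
    calc ρ ^ 2 ≤ (1 / 2) ^ 2 := by gcongr
      _ = 1 / 4 := by norm_num
  have hy2 : ‖y - x₁‖ < 3 / 4 := by
    have h1 : y - x₁ = (x - x₁) - (x - y) := by abel
    rw [h1]
    exact (norm_sub_le _ _).trans_lt (by linarith)
  -- On the diagonal `U + W < μ`, whereas the maximum is at least `μ`.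
  have hxy : x ≠ y := by
    rintro rfl
    linarith [sq_nonneg ‖x - x₁‖, (hUW x hx).2.2]
  refine doubling_contradiction hn hp hθ hσ' hδ1 hL2 hL40 hLτ hLc hκ hUc hWc hUκ hWκ hUs hWs
    hxy hx2.le hy2.le hLd ?_
  have ht : Tendsto (fun z : 𝔼 × 𝔼 => (x + z.1, y + z.2)) (𝓝 0) (𝓝 (x, y)) := by
    have := (by fun_prop : Continuous fun z : 𝔼 × 𝔼 => (x + z.1, y + z.2)).tendsto 0
    simpa using this
  have hnhds : closedBall x₁ 1 ×ˢ closedBall x₁ 1 ∈ 𝓝 (x, y) := by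
    refine prod_mem_nhds ?_ ?_
    · exact Filter.mem_of_superset (isOpen_ball.mem_nhds (by
        rw [mem_ball, dist_eq_norm]; linarith)) ball_subset_closedBall
    · exact Filter.mem_of_superset (isOpen_ball.mem_nhds (by
        rw [mem_ball, dist_eq_norm]; linarith)) ball_subset_closedBall
  filter_upwards [ht.eventually hnhds] with z hz
  exact hmax hz

end HolderEstimate

/-! ### The Gaussian barrier and flatness improvement. -/

section Barrier

open Filter Topology

variable {n : ℕ}

local notation "𝔼" => EuclideanSpace ℝ (Fin n)

theorem gaussian_taylor_two (m k s₀ : ℝ) : ∀ e > 0, ∀ᶠ s in 𝓝 s₀,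
    |-(m * Real.exp (-k * s)) - -(m * Real.exp (-k * s₀)) -
      m * k * Real.exp (-k * s₀) * (s - s₀) -
        -(m * k ^ 2 * Real.exp (-k * s₀)) / 2 * (s - s₀) ^ 2| ≤ e * (s - s₀) ^ 2 := by
  have hexp : ∀ s, HasDerivAt (fun s => Real.exp (-k * s)) (Real.exp (-k * s) * (-k * 1)) s :=
    fun s => ((hasDerivAt_id s).const_mul (-k)).exp
  refine scalar_taylor_two (g := fun s => -(m * Real.exp (-k * s)))
    (g' := fun s => m * k * Real.exp (-k * s)) ?_ ?_
  · refine Eventually.of_forall fun s => (((hexp s).const_mul m).neg).congr_deriv ?_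
    ring
  · refine ((hexp s₀).const_mul (m * k)).congr_deriv ?_
    ring

/-- The bilinear form `2 g₁ ⟨v, w⟩ + 4 g₂ ⟨a, v⟩ ⟨a, w⟩`. -/
noncomputable def radialHessian (g₁ g₂ : ℝ) (a : 𝔼) : 𝔼 →L[ℝ] 𝔼 →L[ℝ] ℝ :=
  (2 * g₁) • innerForm 𝔼 + (4 * g₂) • (innerForm 𝔼 a).smulRight (innerForm 𝔼 a)

theorem radialHessian_self (g₁ g₂ : ℝ) (a v : 𝔼) :
    radialHessian g₁ g₂ a v v = 2 * g₁ * ‖v‖ ^ 2 + 4 * g₂ * inner ℝ a v ^ 2 := by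
  simp only [radialHessian, _root_.add_apply, _root_.smul_apply, smul_eq_mul, innerForm_self,
    ContinuousLinearMap.smulRight_apply, innerForm_apply]
  ring

theorem jetPLaplacian_radial {p g₁ g₂ : ℝ} (hg₁ : 0 < g₁) {a : 𝔼} (ha : a ≠ 0)
    (b : OrthonormalBasis (Fin n) ℝ 𝔼) :
    jetPLaplacian p b ((2 * g₁) • a) (radialHessian g₁ g₂ a) =
      2 * g₁ * (n + p - 2) + 4 * g₂ * ‖a‖ ^ 2 * (p - 1) := by
  have ha' : 0 < ‖a‖ := norm_pos_iff.2 ha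
  have h1 : ‖(2 * g₁) • a‖⁻¹ • (2 * g₁) • a = ‖a‖⁻¹ • a := by
    rw [norm_smul, Real.norm_of_nonneg (by positivity), smul_smul, mul_inv_rev, mul_assoc,
      inv_mul_cancel₀ (by positivity), mul_one]
  have h2 : ‖‖a‖⁻¹ • a‖ = 1 := by
    rw [norm_smul, norm_inv, norm_norm, inv_mul_cancel₀ ha'.ne']
  have h3 : inner ℝ a (‖a‖⁻¹ • a) = ‖a‖ := by
    rw [real_inner_smul_right, real_inner_self_eq_norm_sq]; field_simp
  have h4 : ∑ i, inner ℝ a (b i) ^ 2 = ‖a‖ ^ 2 := b.sum_sq_inner_left a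
  rw [jetPLaplacian, h1, radialHessian_self, h2, h3]
  simp only [radialHessian_self, b.orthonormal.1, Finset.sum_add_distrib, ← Finset.mul_sum, h4]
  simp
  ring

/-- At a point where the Gaussian barrier touches a function from below, the opposite of this
function has an explicit superjet. -/
theorem isUpperJet_neg_of_gaussian {v : 𝔼 → ℝ} {x₁ x : 𝔼} {m k : ℝ}
    (hmin : ∀ᶠ z in 𝓝 x, v x - m * Real.exp (-k * ‖x - x₁‖ ^ 2) ≤
      v z - m * Real.exp (-k * ‖z - x₁‖ ^ 2)) :
    IsUpperJet (fun z => -v z) x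
      (innerSL ℝ ((2 * (m * k * Real.exp (-k * ‖x - x₁‖ ^ 2))) • (x - x₁)))
      (radialHessian (m * k * Real.exp (-k * ‖x - x₁‖ ^ 2))
        (-(m * k ^ 2 * Real.exp (-k * ‖x - x₁‖ ^ 2))) (x - x₁)) := by
  intro e he
  have h1 := radial_taylor_two (g := fun s => -(m * Real.exp (-k * s))) (a := x - x₁)
    (gaussian_taylor_two m k _) e he
  have ht : Tendsto (fun h : 𝔼 => x + h) (𝓝 0) (𝓝 x) := by
    have := (by fun_prop : Continuous fun h : 𝔼 => x + h).tendsto 0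
    rwa [add_zero] at this
  filter_upwards [h1, ht.eventually hmin] with h h2 h3
  have h4 := (abs_le.1 h2).2
  rw [show x + h - x₁ = x - x₁ + h by abel] at h3
  rw [radialHessian_self, innerSL_apply_apply, real_inner_smul_left]
  linarith

/-- The constants in the barrier argument. -/
theorem exists_barrier_constants {p θ σ ρ m : ℝ} (n : ℕ) (hp : 1 < p) (hρ : 0 < ρ) (hm : 0 < m) :
    ∃ k δ : ℝ, 0 < k ∧ 0 < δ ∧ δ ≤ 1 ∧ n + p - 1 ≤ 2 * k * ρ ^ 2 * (p - 1) ∧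
      δ * ((4 * m * k) ^ (1 + θ) + (4 * m * k) ^ σ + 1) <
        (2 * m * k * Real.exp (-k * 4) * ρ) ^ θ * (2 * m * k * Real.exp (-k * 4)) := by
  have hp' : 0 < p - 1 := by linarith
  have hn : (0 : ℝ) ≤ n := Nat.cast_nonneg n
  obtain ⟨k, hk, hkρ⟩ : ∃ k : ℝ, 0 < k ∧ n + p - 1 ≤ 2 * k * ρ ^ 2 * (p - 1) := by
    refine ⟨(n + p - 1) / (2 * ρ ^ 2 * (p - 1)), div_pos (by linarith) (by positivity),
      le_of_eq ?_⟩
    field_simp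
  set P := (4 * m * k) ^ (1 + θ) + (4 * m * k) ^ σ + 1
  set Q := (2 * m * k * Real.exp (-k * 4) * ρ) ^ θ * (2 * m * k * Real.exp (-k * 4))
  have hP : 0 < P := by positivity
  have hQ : 0 < Q := by positivity
  refine ⟨k, min 1 (Q / (2 * P)), hk, by positivity, min_le_left _ _, hkρ, ?_⟩
  calc _ ≤ Q / (2 * P) * P := by gcongr; exact min_le_right _ _
    _ = Q / 2 := by field_simp
    _ < Q := half_lt_self hQ

/-- Quantitative strong maximum principle: a supersolution which is positive on a small ball is
positive nearby. -/
theorem pos_of_barrier {p θ σ ρ m : ℝ} (hp : 1 < p) (hθ : 0 < θ) (hσ : θ < σ) (hρ : 0 < ρ)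
    (hm : 0 < m) :
    ∃ δ : ℝ, 0 < δ ∧ δ ≤ 1 ∧ ∀ (v : 𝔼 → ℝ) (x₁ : 𝔼), ContinuousOn v (closedBall x₁ 2) →
      (∀ z ∈ closedBall x₁ 2, 0 ≤ v z) → (∀ z ∈ closedBall x₁ ρ, m ≤ v z) →
      IsExtremalSubsolution p θ σ δ (ball x₁ 2) (fun z => -v z) → ∀ z ∈ ball x₁ 2, 0 < v z := by
  obtain ⟨k, δ, hk, hδ, hδ1, hkρ, hδk⟩ := exists_barrier_constants (θ := θ) (σ := σ) n hp hρ hm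
  refine ⟨δ, hδ, hδ1, fun v x₁ hv hv0 hvm hvs z₀ hz₀ => ?_⟩
  by_contra hcon
  push Not at hcon
  let w : 𝔼 → ℝ := fun z => v z - m * Real.exp (-k * ‖z - x₁‖ ^ 2)
  have hw : ContinuousOn w (closedBall x₁ 2) := by
    refine hv.sub (Continuous.continuousOn ?_)
    fun_prop
  set A := closedBall x₁ 2 \ ball x₁ ρ with hA
  have hAc : IsCompact A := (isCompact_closedBall x₁ 2).diff isOpen_ball
  have hz₀A : z₀ ∈ A := by
    refine ⟨ball_subset_closedBall hz₀, fun h => ?_⟩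
    linarith [hvm z₀ (ball_subset_closedBall h)]
  obtain ⟨x, hxA, hxmin⟩ := hAc.exists_isMinOn ⟨z₀, hz₀A⟩ (hw.mono sdiff_subset)
  -- A zero of `v` pushes the minimum below the values of `w` on both boundary spheres: at least
  -- `-(m * Real.exp (-k * 4))` on the outer one, at least `0` on the inner one. So the minimum is
  -- interior.
  have hwx : w x < -(m * Real.exp (-k * 4)) := by
    refine (show w x ≤ w z₀ from hxmin hz₀A).trans_lt ?_
    have h1 : ‖z₀ - x₁‖ ^ 2 < 4 := by
      rw [mem_ball, dist_eq_norm] at hz₀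
      nlinarith [norm_nonneg (z₀ - x₁)]
    have h2 : Real.exp (-k * 4) < Real.exp (-k * ‖z₀ - x₁‖ ^ 2) :=
      Real.exp_lt_exp.2 (by nlinarith)
    have h3 := mul_lt_mul_of_pos_left h2 hm
    simp only [w]
    linarith
  have hx2 : ‖x - x₁‖ < 2 := by
    have h1 := hxA.1
    rw [mem_closedBall, dist_eq_norm] at h1
    refine lt_of_le_of_ne h1 fun h2 => ?_
    have h3 := hv0 x hxA.1
    simp only [w, h2] at hwx
    norm_num at hwx
    linarith
  have hxρ : ρ < ‖x - x₁‖ := by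
    have h1 := hxA.2
    rw [mem_ball, dist_eq_norm, not_lt] at h1
    refine lt_of_le_of_ne h1 fun h2 => ?_
    have h3 := hvm x (by rw [mem_closedBall, dist_eq_norm, h2])
    have h4 : Real.exp (-k * ‖x - x₁‖ ^ 2) ≤ 1 := by
      rw [Real.exp_le_one_iff]
      nlinarith [sq_nonneg ‖x - x₁‖]
    have h5 : 0 < m * Real.exp (-k * 4) := by positivity
    simp only [w] at hwx
    nlinarith
  have hxb : x ∈ ball x₁ 2 := by rwa [mem_ball, dist_eq_norm]
  have hnear : ∀ᶠ z in 𝓝 x, z ∈ A := by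
    have h1 : ∀ᶠ z in 𝓝 x, z ∈ ball x₁ 2 := isOpen_ball.mem_nhds hxb
    have h2 : ∀ᶠ z in 𝓝 x, z ∈ (closedBall x₁ ρ)ᶜ := isClosed_closedBall.isOpen_compl.mem_nhds (by
      rw [mem_compl_iff, mem_closedBall, dist_eq_norm, not_le]; exact hxρ)
    filter_upwards [h1, h2] with z hz1 hz2
    exact ⟨ball_subset_closedBall hz1, fun h => hz2 (ball_subset_closedBall h)⟩
  have hjet := isUpperJet_neg_of_gaussian (v := v) (x₁ := x₁) (x := x) (m := m) (k := k) (by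
    filter_upwards [hnear] with z hz
    exact hxmin hz)
  set a := x - x₁ with ha
  set E := Real.exp (-k * ‖a‖ ^ 2) with hE
  have ha0 : 0 < ‖a‖ := hρ.trans hxρ
  have ha0' : a ≠ 0 := norm_pos_iff.1 ha0
  have hE0 : 0 < E := Real.exp_pos _
  have hE1 : E ≤ 1 := by
    rw [hE, Real.exp_le_one_iff]; nlinarith [sq_nonneg ‖a‖]
  have hE4 : Real.exp (-k * 4) ≤ E := by
    have h4 : ‖a‖ ^ 2 ≤ 4 := by nlinarith
    rw [hE]; refine Real.exp_le_exp.2 ?_; nlinarith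
  have hg : 0 < m * k * E := by positivity
  have hξ0 : (2 * (m * k * E)) • a ≠ 0 := smul_ne_zero (by positivity) ha0'
  have hineq := hvs x hxb _ hξ0 _ hjet (EuclideanSpace.basisFun (Fin n) ℝ)
  rw [jetPLaplacian_radial hg ha0'] at hineq
  have hnorm : ‖(2 * (m * k * E)) • a‖ = 2 * (m * k * E) * ‖a‖ := by
    rw [norm_smul, Real.norm_of_nonneg (by positivity)]
  rw [hnorm] at hineq
  set N := 2 * (m * k * E) * ‖a‖ with hN
  have hNup : N ≤ 4 * m * k := by
    calc N ≤ 2 * (m * k * 1) * 2 := by rw [hN]; gcongr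
      _ = _ := by ring
  have hNlow : 2 * m * k * Real.exp (-k * 4) * ρ ≤ N := by
    calc _ = 2 * (m * k * Real.exp (-k * 4)) * ρ := by ring
      _ ≤ N := by rw [hN]; gcongr
  have hN0 : 0 < N := by positivity
  -- Outside radius `ρ`, the choice of `k` makes the radial second derivative dominate the
  -- tangential ones.
  have hF : 2 * (m * k * E) * (n + p - 2) + 4 * -(m * k ^ 2 * E) * ‖a‖ ^ 2 * (p - 1) ≤
      -(2 * m * k * Real.exp (-k * 4)) := by
    have h1 : 2 * k * ρ ^ 2 * (p - 1) ≤ 2 * k * ‖a‖ ^ 2 * (p - 1) := by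
      have : 0 ≤ p - 1 := by linarith
      gcongr
    have h2 : 2 * (m * k * E) * (n + p - 1 - 2 * k * ‖a‖ ^ 2 * (p - 1)) ≤ 0 :=
      mul_nonpos_of_nonneg_of_nonpos (by positivity) (by linarith)
    have h3 : 2 * m * k * Real.exp (-k * 4) ≤ 2 * m * k * E := by gcongr
    linarith
  have h1 : δ * (N ^ (1 + θ) + N ^ σ + 1) ≤
      δ * ((4 * m * k) ^ (1 + θ) + (4 * m * k) ^ σ + 1) := by
    have := hθ.trans hσ
    gcongr
  have h2 : (2 * m * k * Real.exp (-k * 4) * ρ) ^ θ * (2 * m * k * Real.exp (-k * 4)) ≤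
      N ^ θ * (2 * m * k * Real.exp (-k * 4)) := by gcongr
  have h3 := mul_le_mul_of_nonneg_left hF (show 0 ≤ N ^ θ by positivity)
  linarith

/-- Flatness improvement: if the coefficients are small and `v` vanishes at the origin, then `v` is
small around the origin. -/
theorem exists_flatness_improvement {p θ σ η : ℝ} (hn : 0 < n) (hp : 1 < p) (hθ : 0 < θ)
    (hσ : θ < σ) (hσ' : σ < 1 + θ) (hη : 0 < η) :
    ∃ δ : ℝ, 0 < δ ∧ ∀ v : 𝔼 → ℝ, ContinuousOn v (ball 0 4) →
      (∀ z ∈ ball (0 : 𝔼) 4, 0 ≤ v z ∧ v z ≤ 1) → v 0 = 0 →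
      IsExtremalSubsolution p θ σ δ (ball 0 4) v →
      IsExtremalSubsolution p θ σ δ (ball 0 4) (fun z => -v z) →
      ∀ z ∈ ball (0 : 𝔼) 1, v z ≤ η := by
  obtain ⟨L, hL, hLest⟩ := exists_holder_estimate (n := n) hn hp hθ hσ'
  -- Since `L` serves all `δ ≤ 1`, the radius `ρ` can be fixed before the barrier determines `δ`.
  obtain ⟨ρ, hρ, hρ1, hρη⟩ : ∃ ρ : ℝ, 0 < ρ ∧ ρ < 1 ∧ L * (ρ ^ 2) ^ (1 / 4 : ℝ) < η / 2 := by
    have h1 : Tendsto (fun t : ℝ => L * (t ^ 2) ^ (1 / 4 : ℝ)) (𝓝[>] 0)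
        (𝓝 (L * ((0 : ℝ) ^ 2) ^ (1 / 4 : ℝ))) := by
      refine (Continuous.tendsto ?_ 0).mono_left nhdsWithin_le_nhds
      exact continuous_const.mul ((continuous_pow 2).rpow_const fun _ => Or.inr (by norm_num))
    rw [zero_pow two_ne_zero, Real.zero_rpow (by norm_num), mul_zero] at h1
    obtain ⟨ρ, h2, h3⟩ := ((h1.eventually (gt_mem_nhds (half_pos hη))).and
      (Ioo_mem_nhdsGT zero_lt_one)).exists
    exact ⟨ρ, h3.1, h3.2, h2⟩
  obtain ⟨δ, hδ, hδ1, hbar⟩ := pos_of_barrier (n := n) hp hθ hσ hρ (half_pos hη)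
  refine ⟨δ, hδ, fun v hv hv01 hv0 hvs hvs' x₁ hx₁ => ?_⟩
  by_contra hcon
  push Not at hcon
  rw [mem_ball_zero_iff] at hx₁
  have hsub : closedBall x₁ 2 ⊆ ball 0 4 := by
    refine closedBall_subset_ball' ?_
    rw [dist_zero_right]; linarith
  have hsub' : ball x₁ 2 ⊆ ball 0 4 := ball_subset_closedBall.trans hsub
  have hH := hLest δ v x₁ hδ1 (hv.mono hsub) (fun z hz => hv01 z (hsub hz))
    (fun x hx => hvs x (hsub' hx)) (fun x hx => hvs' x (hsub' hx))
  have hpos := hbar v x₁ (hv.mono hsub) (fun z hz => (hv01 z (hsub hz)).1) (fun z hz => by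
    have h1 := hH z (closedBall_subset_closedBall hρ1.le hz)
    have h2 : L * (‖x₁ - z‖ ^ 2) ^ (1 / 4 : ℝ) ≤ L * (ρ ^ 2) ^ (1 / 4 : ℝ) := by
      rw [mem_closedBall, dist_comm, dist_eq_norm] at hz
      gcongr
    linarith) (fun x hx => hvs' x (hsub' hx)) 0 (by
      rw [mem_ball, dist_comm, dist_zero_right]; linarith)
  linarith

end Barrier

/-! ### Rescaling and iteration. -/

section Regularity

open Filter Topology

variable {n : ℕ}

local notation "𝔼" => EuclideanSpace ℝ (Fin n)

/-- By continuity the set where the bound fails is open; being null, it is empty. Boundedness keeps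
`toReal` from returning its default value `0` at `∞`. -/
theorem le_linftyNorm {u : 𝔼 → ℝ} {Ω : Set 𝔼} (hΩ : IsOpen Ω) (hu : ContinuousOn u Ω) {M : ℝ}
    (hM : ∀ x ∈ Ω, |u x| ≤ M) {x : 𝔼} (hx : x ∈ Ω) : u x ≤ linftyNorm Ω u := by
  have hfin : eLpNorm u ∞ (volume.restrict Ω) ≠ ∞ := by
    refine ne_top_of_le_ne_top ENNReal.ofReal_ne_top (b := ENNReal.ofReal M) ?_
    rw [eLpNorm_exponent_top]
    refine eLpNormEssSup_le_of_ae_bound ?_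
    filter_upwards [ae_restrict_mem hΩ.measurableSet] with y hy using hM y hy
  have hae : ∀ᵐ y ∂volume.restrict Ω, u y ≤ linftyNorm Ω u := by
    filter_upwards [ae_le_eLpNormEssSup (f := u) (μ := volume.restrict Ω)] with y hy
    have h1 := ENNReal.toReal_mono (by rwa [eLpNorm_exponent_top] at hfin) hy
    rw [toReal_enorm] at h1
    rw [linftyNorm, eLpNorm_exponent_top]
    exact (le_abs_self _).trans h1
  by_contra hcon
  push Not at hcon
  have hopen : IsOpen (Ω ∩ u ⁻¹' Ioi (linftyNorm Ω u)) := hu.isOpen_inter_preimage hΩ isOpen_Ioi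
  have hpos := hopen.measure_pos volume ⟨x, hx, hcon⟩
  rw [ae_restrict_iff' hΩ.measurableSet] at hae
  refine hpos.ne' (measure_mono_null (fun y hy => ?_) hae)
  simp only [mem_compl_iff, mem_ofPred_eq]
  exact fun h => absurd (h hy.1) (not_le.2 hy.2)

theorem abs_hamiltonian_le {θ σ b R : ℝ} {B : 𝔼 → 𝔼} {ϱ : 𝔼 → ℝ} {ξ x : 𝔼} (hξ : ξ ≠ 0)
    (hB : ‖B x‖ ≤ b) (hϱ : |ϱ x| ≤ R) :
    |hamiltonian θ σ B ϱ ξ x| ≤ b * ‖ξ‖ ^ (1 + θ) + R * ‖ξ‖ ^ σ := by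
  have h0 : 0 < ‖ξ‖ := norm_pos_iff.2 hξ
  rw [hamiltonian]
  refine (abs_add_le _ _).trans ?_
  rw [abs_mul, abs_mul, abs_of_nonneg (show 0 ≤ ‖ξ‖ ^ θ by positivity),
    abs_of_nonneg (show 0 ≤ ‖ξ‖ ^ σ by positivity), Real.rpow_add h0, Real.rpow_one, ← mul_assoc]
  gcongr
  exact (abs_real_inner_le_norm _ _).trans (by gcongr)

/-- Rescalings of solutions solve the extremal equation. -/
theorem IsViscositySolution.isExtremalSubsolution_rescaled {p θ σ b R G δ r M : ℝ}
    {B : 𝔼 → 𝔼} {ϱ u : 𝔼 → ℝ} {f₀ : 𝔼 → ℝ → ℝ} {Ω : Set 𝔼} {x₀ : 𝔼}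
    (hu : IsViscositySolution p θ (hamiltonian θ σ B ϱ) f₀ Ω u) (hr : 0 < r) (hM : 0 < M)
    (hΩ : ball x₀ (4 * r) ⊆ Ω) (hB : ∀ x ∈ Ω, ‖B x‖ ≤ b) (hϱ : ∀ x ∈ Ω, |ϱ x| ≤ R)
    (hf : ∀ x ∈ ball x₀ (4 * r), |f₀ x (u x)| ≤ G)
    (h1 : b * (M / r) ^ (1 + θ) ≤ δ * ((M / r) ^ θ * (M / r ^ 2)))
    (h2 : R * (M / r) ^ σ ≤ δ * ((M / r) ^ θ * (M / r ^ 2)))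
    (h3 : G ≤ δ * ((M / r) ^ θ * (M / r ^ 2))) :
    IsExtremalSubsolution p θ σ δ (ball 0 4) (fun y => u (x₀ + r • y) / M) ∧
      IsExtremalSubsolution p θ σ δ (ball 0 4) (fun y => -(u (x₀ + r • y) / M)) := by
  have hmem : ∀ y ∈ ball (0 : 𝔼) 4, x₀ + r • y ∈ ball x₀ (4 * r) := by
    intro y hy
    rw [mem_ball_zero_iff] at hy
    rw [mem_ball, dist_eq_norm, add_sub_cancel_left, norm_smul, Real.norm_of_nonneg hr.le]
    nlinarith
  set s := M / r with hs
  set t := M / r ^ 2 with ht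
  have hs0 : 0 < s := by positivity
  have ht0 : 0 < t := by positivity
  have hjet : ∀ ξ : 𝔼, (M / r) • innerSL ℝ ξ = innerSL ℝ (s • ξ) := fun ξ => by
    ext v; simp [hs]
  have hκ : 0 < s ^ θ * t := by positivity
  -- Gradients scale by `s` and Hessians by `t`; dividing by `s ^ θ * t` normalizes the principal
  -- part.
  have key : ∀ y ∈ ball (0 : 𝔼) 4, ∀ ξ : 𝔼, ξ ≠ 0 → ∀ J : ℝ,
      -(b * ‖s • ξ‖ ^ (1 + θ) + R * ‖s • ξ‖ ^ σ + G) ≤ ‖s • ξ‖ ^ θ * (t * J) →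
      -(δ * (‖ξ‖ ^ (1 + θ) + ‖ξ‖ ^ σ + 1)) ≤ ‖ξ‖ ^ θ * J := by
    intro y hy ξ hξ J hJ
    rw [norm_smul, Real.norm_of_nonneg hs0.le, Real.mul_rpow hs0.le (norm_nonneg _),
      Real.mul_rpow hs0.le (norm_nonneg _), Real.mul_rpow hs0.le (norm_nonneg _)] at hJ
    have e1 := mul_le_mul_of_nonneg_right h1 (show 0 ≤ ‖ξ‖ ^ (1 + θ) by positivity)
    have e2 := mul_le_mul_of_nonneg_right h2 (show 0 ≤ ‖ξ‖ ^ σ by positivity)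
    refine le_of_mul_le_mul_left ?_ hκ
    linarith
  constructor
  · intro y hy ξ hξ X hX c
    have hx := hmem y hy
    have hj := hX.of_scaling hr hM
    rw [hjet] at hj
    have hsξ : s • ξ ≠ 0 := smul_ne_zero hs0.ne' hξ
    have h4 := hu.2.1.le_of_isUpperJet (hΩ hx) hsξ hj c
    rw [jetPLaplacian_smul p c hs0] at h4
    refine key y hy ξ hξ _ ?_
    have h5 := (abs_le.1 (abs_hamiltonian_le (θ := θ) (σ := σ) hsξ (hB _ (hΩ hx)) (hϱ _ (hΩ hx)))).2
    have h6 := (abs_le.1 (hf _ hx)).1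
    linarith
  · intro y hy ξ hξ X hX c
    have hx := hmem y hy
    have hj := IsUpperJet.of_scaling (u := fun x => -u x) (x₀ := x₀) hr hM (y := y)
      (ξ := innerSL ℝ ξ) (X := X) (by simpa only [neg_div] using hX)
    rw [hjet] at hj
    have hsξ : s • ξ ≠ 0 := smul_ne_zero hs0.ne' hξ
    have h4 := hu.2.2.le_of_isUpperJet_neg (hΩ hx) hsξ hj c
    rw [jetPLaplacian_smul p c hs0] at h4
    refine key y hy ξ hξ _ ?_
    have h5 := (abs_le.1 (abs_hamiltonian_le (θ := θ) (σ := σ) (neg_ne_zero.2 hsξ) (hB _ (hΩ hx))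
      (hϱ _ (hΩ hx)))).1
    rw [norm_neg] at h5
    have h6 := (abs_le.1 (hf _ hx)).2
    linarith

/-- The smallness conditions on the rescaled coefficients at the natural scaling. -/
theorem rescaled_coefficients_le {θ σ m α β b R c δ A ρ : ℝ}
    (hσ' : σ < 1 + θ) (hβ : β * (1 + θ - m) = 2 + θ + α)
    (hR : 0 ≤ R) (hRβ : R = 0 ∨ (β - 1) * (1 + θ - σ) ≤ 1) (hδ : 0 < δ) (hA : 0 < A)
    (hρ : 0 < ρ) (hρ1 : ρ ≤ 1) (hbρ : b * ρ ≤ δ) (hb : 0 ≤ b) (hθ : 0 < θ)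
    (hRA : R ≤ δ * A ^ (1 + θ - σ)) (hcA : c ≤ δ * A ^ (1 + θ - m)) :
    b * (A * ρ ^ β / (ρ / 4)) ^ (1 + θ) ≤
        δ * ((A * ρ ^ β / (ρ / 4)) ^ θ * (A * ρ ^ β / (ρ / 4) ^ 2)) ∧
      R * (A * ρ ^ β / (ρ / 4)) ^ σ ≤
        δ * ((A * ρ ^ β / (ρ / 4)) ^ θ * (A * ρ ^ β / (ρ / 4) ^ 2)) ∧
      c * ρ ^ α * (A * ρ ^ β) ^ m ≤
        δ * ((A * ρ ^ β / (ρ / 4)) ^ θ * (A * ρ ^ β / (ρ / 4) ^ 2)) := by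
  set M := A * ρ ^ β with hM
  have hM0 : 0 < M := by positivity
  set r := ρ / 4 with hr
  have hr0 : 0 < r := by positivity
  set s := M / r with hs
  have hs0 : 0 < s := by positivity
  have ht : M / r ^ 2 = s / r := by rw [hs]; field_simp
  refine ⟨?_, ?_, ?_⟩
  · rw [ht, add_comm, Real.rpow_add_one hs0.ne']
    have h1 : b ≤ δ / r := by
      rw [le_div_iff₀ hr0]
      have : b * r ≤ b * ρ := by gcongr; linarith
      linarith
    calc b * (s ^ θ * s) ≤ δ / r * (s ^ θ * s) := by gcongr
      _ = _ := by ring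
  · rcases hRβ with h0 | hβσ
    · rw [h0, zero_mul]; positivity
    have hε : 0 < 1 + θ - σ := by linarith
    have h1 : A * ρ ^ (β - 1) ≤ s := by
      rw [hs, hr, hM, Real.rpow_sub_one hρ.ne']
      have : A * ρ ^ β / (ρ / 4) = 4 * (A * (ρ ^ β / ρ)) := by field_simp
      rw [this]
      have : 0 < A * (ρ ^ β / ρ) := by positivity
      linarith
    -- The condition on `β` enters here: since `ρ ≤ 1`, a power of `ρ` with exponent at most `1` is
    -- at least `ρ`.
    have h2 : A ^ (1 + θ - σ) * ρ ≤ s ^ (1 + θ - σ) := by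
      refine le_trans ?_ (Real.rpow_le_rpow (by positivity) h1 hε.le)
      rw [Real.mul_rpow hA.le (by positivity), ← Real.rpow_mul hρ.le]
      gcongr
      calc ρ = ρ ^ (1 : ℝ) := (Real.rpow_one ρ).symm
        _ ≤ _ := Real.rpow_le_rpow_of_exponent_ge hρ hρ1 hβσ
    have h3 : R * r ≤ δ * s ^ (1 + θ - σ) := by
      calc R * r ≤ R * ρ := by gcongr; linarith
        _ ≤ δ * A ^ (1 + θ - σ) * ρ := by gcongr
        _ = δ * (A ^ (1 + θ - σ) * ρ) := by ring
        _ ≤ _ := by gcongr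
    have h4 : s ^ θ * s = s ^ σ * s ^ (1 + θ - σ) := by
      rw [← Real.rpow_add_one hs0.ne', ← Real.rpow_add hs0]; congr 1; ring
    have h5 : R ≤ δ * s ^ (1 + θ - σ) / r := by rwa [le_div_iff₀ hr0]
    rw [ht]
    calc R * s ^ σ ≤ δ * s ^ (1 + θ - σ) / r * s ^ σ := by gcongr
      _ = δ * (s ^ σ * s ^ (1 + θ - σ)) / r := by ring
      _ = _ := by rw [← h4]; ring
  · have h1 : M ^ (1 + θ - m) = A ^ (1 + θ - m) * (ρ ^ θ * ρ ^ 2 * ρ ^ α) := by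
      rw [hM, Real.mul_rpow hA.le (by positivity), ← Real.rpow_mul hρ.le, hβ, ← Real.rpow_natCast,
        ← Real.rpow_add hρ, ← Real.rpow_add hρ]
      congr 2; push_cast; ring
    have h2 : M ^ θ * M = M ^ m * M ^ (1 + θ - m) := by
      rw [← Real.rpow_add_one hM0.ne', ← Real.rpow_add hM0]; congr 1; ring
    have h3 : r ^ θ * r ^ 2 ≤ ρ ^ θ * ρ ^ 2 := by
      have : r ≤ ρ := by linarith
      gcongr
    have h4 : s ^ θ * (M / r ^ 2) = M ^ θ * M / (r ^ θ * r ^ 2) := by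
      rw [hs, Real.div_rpow hM0.le hr0.le]; field_simp
    rw [h4, h2]
    calc c * ρ ^ α * M ^ m ≤ δ * A ^ (1 + θ - m) * ρ ^ α * M ^ m := by gcongr
      _ = δ * (M ^ m * M ^ (1 + θ - m) / (ρ ^ θ * ρ ^ 2)) := by rw [h1]; field_simp
      _ ≤ _ := by gcongr

/-- Decay on geometric balls from a one-step improvement. -/
theorem le_of_geometric_decay {u : 𝔼 → ℝ} {x₀ : 𝔼} {A β ρ₀ : ℝ} (hA : 0 ≤ A) (hβ : 0 < β)
    (hρ₀ : 0 < ρ₀) (h0 : ∀ x ∈ ball x₀ ρ₀, u x ≤ A * ρ₀ ^ β)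
    (hstep : ∀ ρ, 0 < ρ → ρ ≤ ρ₀ → (∀ x ∈ ball x₀ ρ, u x ≤ A * ρ ^ β) →
      ∀ x ∈ ball x₀ (ρ / 4), u x ≤ A * (ρ / 4) ^ β) {x : 𝔼} (hx : x ∈ ball x₀ ρ₀) (hxx : x ≠ x₀) :
    u x ≤ A * 4 ^ β * ‖x - x₀‖ ^ β := by
  have hall : ∀ j : ℕ, ∀ y ∈ ball x₀ (ρ₀ * (1 / 4) ^ j), u y ≤ A * (ρ₀ * (1 / 4) ^ j) ^ β := by
    intro j
    induction j with
    | zero => simpa using h0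
    | succ j ih =>
      have h1 := hstep (ρ₀ * (1 / 4) ^ j) (by positivity)
        (mul_le_of_le_one_right hρ₀.le (pow_le_one₀ (by norm_num) (by norm_num))) ih
      have h2 : ρ₀ * (1 / 4) ^ j / 4 = ρ₀ * (1 / 4) ^ (j + 1) := by rw [pow_succ]; ring
      rwa [h2] at h1
  have hd0 : 0 < ‖x - x₀‖ := norm_pos_iff.2 (sub_ne_zero.2 hxx)
  rw [mem_ball, dist_eq_norm] at hx
  obtain ⟨j, hj1, hj2⟩ := exists_nat_pow_near_of_lt_one (x := ‖x - x₀‖ / ρ₀) (y := 1 / 4)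
    (by positivity) ((div_lt_one hρ₀).2 hx).le (by norm_num) (by norm_num)
  rw [lt_div_iff₀ hρ₀] at hj1
  rw [div_le_iff₀ hρ₀] at hj2
  have hfin : ∀ k : ℕ, ‖x - x₀‖ < ρ₀ * (1 / 4) ^ k → ρ₀ * (1 / 4) ^ k ≤ 4 * ‖x - x₀‖ →
      u x ≤ A * 4 ^ β * ‖x - x₀‖ ^ β := by
    intro k hk1 hk2
    refine (hall k x (by rwa [mem_ball, dist_eq_norm])).trans ?_
    rw [mul_assoc, ← Real.mul_rpow (by norm_num) hd0.le]
    exact mul_le_mul_of_nonneg_left (Real.rpow_le_rpow (by positivity) hk2 hβ.le) hA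
  -- The balls are open, so a point lying exactly on a sphere of the sequence is handled with the
  -- next larger ball.
  rcases hj2.eq_or_lt with heq | hlt
  · cases j with
    | zero => rw [pow_zero, one_mul] at heq; exact absurd heq hx.ne
    | succ i =>
      rw [pow_succ] at heq
      have hi : 0 < ρ₀ * (1 / 4) ^ i := by positivity
      exact hfin i (by linarith) (by linarith)
  · rw [pow_succ] at hj1
    exact hfin j (by linarith) (by linarith)

theorem eventually_le_const_mul_rpow {δ e c : ℝ} (hδ : 0 < δ) (he : 0 < e) :
    ∀ᶠ A in atTop, c ≤ δ * A ^ e :=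
  ((tendsto_rpow_atTop he).const_mul_atTop hδ).eventually (eventually_ge_atTop c)

/-- The bound on `α`, rewritten as the condition that the term in `ϱ` does not grow under the
rescaling. -/
theorem scaling_exponent_le {θ σ m α : ℝ} (hσ' : σ < 1 + θ) (hm' : m < 1 + θ)
    (hα : α ≤ (σ - m * (2 + θ - σ)) / (1 + θ - σ)) :
    ((2 + θ + α) / (1 + θ - m) - 1) * (1 + θ - σ) ≤ 1 := by
  have h1 : 0 < 1 + θ - σ := by linarith
  have h2 : 0 < 1 + θ - m := by linarith
  rw [le_div_iff₀ h1] at hα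
  have h3 : (2 + θ + α) / (1 + θ - m) - 1 = (1 + m + α) / (1 + θ - m) := by field_simp; ring
  rw [h3, div_mul_eq_mul_div, div_le_one h2]
  linarith

end Regularity

theorem mainTheorem5 (n : ℕ) (hn : 1 ≤ n) (p θ σ m α : ℝ)
    (hp : 1 < p) (hθ : 0 < θ) (hσ : θ < σ) (hσ' : σ < 1 + θ)
    (hm : 0 ≤ m) (hm' : m < 1 + θ) (hα : 0 < α)
    (b r c₁ c₂ : ℝ) (hc₁ : 0 < c₁) :
    ∃ C : ℝ, 0 < C ∧
      ∀ (B : EuclideanSpace ℝ (Fin n) → EuclideanSpace ℝ (Fin n))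
        (ϱ f u : EuclideanSpace ℝ (Fin n) → ℝ) (F : Set (EuclideanSpace ℝ (Fin n))),
        ContinuousOn B (closedBall 0 1) → (∀ x ∈ ball 0 1, ‖B x‖ ≤ b) →
        ContinuousOn ϱ (closedBall 0 1) → (∀ x ∈ ball 0 1, |ϱ x| ≤ r) →
        -- the sublinear case, in which the term with exponent `σ` is present
        ((∃ x ∈ ball 0 1, ϱ x ≠ 0) →
          α ≤ (σ - m * (2 + θ - σ)) / (1 + θ - σ) ∧ m ≤ σ / (2 + θ - σ)) →
        IsCompact F → F.Nonempty → F ⊆ ball 0 1 →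
        ContinuousOn f (ball 0 1) →
        (∀ x ∈ ball 0 1, c₁ * infDist x F ^ α ≤ f x ∧ f x ≤ c₂ * infDist x F ^ α) →
        (∀ x ∈ ball 0 1, 0 ≤ u x) → (∃ M : ℝ, ∀ x ∈ ball 0 1, u x ≤ M) →
        IsViscositySolution p θ (hamiltonian θ σ B ϱ) (fun x s => f x * max s 0 ^ m)
          (ball 0 1) u →
        ∀ x₀ ∈ ball 0 (1 / 2), f x₀ = 0 → x₀ ∈ frontier {x | x ∈ ball 0 1 ∧ 0 < u x} →
          ∀ x ∈ ball 0 (1 / 2), 0 < u x →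
            u x ≤ C * max 1 (linftyNorm (ball 0 1) u) *
              ‖x - x₀‖ ^ ((2 + θ + α) / (1 + θ - m)) := by
  set β := (2 + θ + α) / (1 + θ - m) with hβdef
  have hmθ : 0 < 1 + θ - m := by linarith
  have hβ0 : 0 < β := by positivity
  have hβ : β * (1 + θ - m) = 2 + θ + α := by rw [hβdef]; field_simp
  obtain ⟨δ, hδ, hflat⟩ := exists_flatness_improvement (n := n) (p := p) (η := (1 / 4 : ℝ) ^ β)
    (by omega) hp hθ hσ hσ' (by positivity)
  obtain ⟨K, ⟨hK1, hKr⟩, hKc⟩ := (((Filter.eventually_ge_atTop (1 : ℝ)).and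
    (eventually_le_const_mul_rpow (c := |r|) hδ (show 0 < 1 + θ - σ by linarith))).and
    (eventually_le_const_mul_rpow (c := |c₂|) hδ hmθ)).exists
  obtain ⟨ρ₀, hρ₀, hρ₀2, hbρ₀⟩ : ∃ ρ₀ : ℝ, 0 < ρ₀ ∧ ρ₀ ≤ 1 / 2 ∧ |b| * ρ₀ ≤ δ := by
    refine ⟨min (1 / 2) (δ / (|b| + 1)), by positivity, min_le_left _ _, ?_⟩
    calc |b| * min (1 / 2) (δ / (|b| + 1)) ≤ (|b| + 1) * (δ / (|b| + 1)) := by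
          gcongr
          · linarith
          · exact min_le_right _ _
      _ = δ := by field_simp
  have hK0 : 0 < K := by linarith
  refine ⟨K / ρ₀ ^ β * 4 ^ β, by positivity, ?_⟩
  intro B ϱ f u F _ hB _ hϱ hsub hFc hFne _ _ hf hu0 hubd hu x₀ hx₀ hfx₀ hx₀fr x hx hux
  have h21 : ball (0 : EuclideanSpace ℝ (Fin n)) (1 / 2) ⊆ ball 0 1 :=
    ball_subset_ball (by norm_num)
  have hx₀1 := h21 hx₀
  have huc : ContinuousOn u (ball 0 1) := hu.1
  have hux₀ : u x₀ = 0 := by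
    refine le_antisymm (not_lt.1 fun hpos => ?_) (hu0 x₀ hx₀1)
    have hopen : IsOpen {x | x ∈ ball (0 : EuclideanSpace ℝ (Fin n)) 1 ∧ 0 < u x} :=
      huc.isOpen_inter_preimage isOpen_ball isOpen_Ioi
    rw [hopen.frontier_eq] at hx₀fr
    exact hx₀fr.2 ⟨hx₀1, hpos⟩
  have hx₀F : x₀ ∈ F := by
    rw [hFc.isClosed.mem_iff_infDist_zero hFne]
    by_contra hne
    have h1 : 0 < infDist x₀ F := lt_of_le_of_ne infDist_nonneg (Ne.symm hne)
    have h2 := (hf x₀ hx₀1).1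
    rw [hfx₀] at h2
    have h3 : 0 < c₁ * infDist x₀ F ^ α := by positivity
    linarith
  obtain ⟨M, hM⟩ := hubd
  have hule : ∀ y ∈ ball (0 : EuclideanSpace ℝ (Fin n)) 1, u y ≤ max 1 (linftyNorm (ball 0 1) u) :=
    fun y hy => (le_linftyNorm isOpen_ball huc (M := M) (fun z hz => by
      rw [abs_of_nonneg (hu0 z hz)]; exact hM z hz) hy).trans (le_max_right _ _)
  set N := max 1 (linftyNorm (ball 0 1) u)
  have hN1 : 1 ≤ N := le_max_left _ _
  have hN0 : 0 < N := by linarith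
  obtain ⟨R, hR0, hRr, hϱR, hRβ⟩ : ∃ R, 0 ≤ R ∧ R ≤ |r| ∧
      (∀ y ∈ ball (0 : EuclideanSpace ℝ (Fin n)) 1, |ϱ y| ≤ R) ∧
      (R = 0 ∨ (β - 1) * (1 + θ - σ) ≤ 1) := by
    by_cases h : ∃ y ∈ ball (0 : EuclideanSpace ℝ (Fin n)) 1, ϱ y ≠ 0
    · exact ⟨|r|, abs_nonneg _, le_rfl, fun y hy => (hϱ y hy).trans (le_abs_self _),
        Or.inr (scaling_exponent_le hσ' hm' (hsub h).1)⟩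
    · push Not at h
      exact ⟨0, le_rfl, abs_nonneg _, fun y hy => by rw [h y hy, abs_zero], Or.inl rfl⟩
  -- Large enough both to dominate the coefficients (`K ≤ A`) and to start the iteration at radius
  -- `ρ₀` (`N ≤ A * ρ₀ ^ β`).
  set A := K / ρ₀ ^ β * N with hA
  have hKA : K ≤ A := by
    have h1 : ρ₀ ^ β ≤ 1 := Real.rpow_le_one hρ₀.le (by linarith) hβ0.le
    calc K ≤ K / ρ₀ ^ β := by
          rw [le_div_iff₀ (by positivity)]
          exact mul_le_of_le_one_right hK0.le h1
      _ ≤ A := le_mul_of_one_le_right (by positivity) hN1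
  have hA0 : 0 < A := by linarith
  have hNA : N ≤ A * ρ₀ ^ β := by
    have : A * ρ₀ ^ β = K * N := by rw [hA]; field_simp
    rw [this]
    exact le_mul_of_one_le_left hN0.le hK1
  have hball : ∀ ρ, ρ ≤ ρ₀ → ball x₀ ρ ⊆ ball 0 1 := fun ρ hρ => by
    refine ball_subset_ball' ?_
    rw [mem_ball] at hx₀
    linarith
  have hstep : ∀ ρ, 0 < ρ → ρ ≤ ρ₀ → (∀ x ∈ ball x₀ ρ, u x ≤ A * ρ ^ β) →
      ∀ x ∈ ball x₀ (ρ / 4), u x ≤ A * (ρ / 4) ^ β := by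
    intro ρ hρ hρρ₀ hdec y hy
    obtain ⟨h1, h2, h3⟩ := rescaled_coefficients_le (b := |b|) (c := |c₂|) (m := m) (α := α)
      (β := β) (ρ := ρ) (A := A) hσ' hβ hR0 hRβ hδ hA0 hρ (by linarith)
      (le_trans (by gcongr) hbρ₀) (abs_nonneg b) hθ
      (hRr.trans (hKr.trans (by gcongr))) (hKc.trans (by gcongr))
    have h4ρ : 4 * (ρ / 4) = ρ := by ring
    have hMpos : 0 < A * ρ ^ β := by positivity
    have hρ4 : 0 < ρ / 4 := by positivity
    have hclass := hu.isExtremalSubsolution_rescaled (b := |b|) (R := R)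
      (G := |c₂| * ρ ^ α * (A * ρ ^ β) ^ m) (δ := δ) (x₀ := x₀) (r := ρ / 4) (M := A * ρ ^ β)
      hρ4 hMpos (by rw [h4ρ]; exact hball ρ hρρ₀) (fun z hz => (hB z hz).trans (le_abs_self b))
      hϱR (by
        rw [h4ρ]
        intro z hz
        have hz1 := hball ρ hρρ₀ hz
        have h4 : infDist z F ≤ ρ := (infDist_le_dist_of_mem hx₀F).trans (mem_ball.1 hz).le
        have h5 : 0 ≤ infDist z F ^ α := Real.rpow_nonneg infDist_nonneg _
        have h6 : |f z| ≤ |c₂| * ρ ^ α := by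
          have h7 := hf z hz1
          have h8 : 0 ≤ c₁ * infDist z F ^ α := by positivity
          rw [abs_of_nonneg (h8.trans h7.1)]
          refine h7.2.trans ?_
          have h9 : 0 ≤ infDist z F := infDist_nonneg
          gcongr
          exact le_abs_self c₂
        rw [max_eq_left (hu0 z hz1), abs_mul,
          abs_of_nonneg (Real.rpow_nonneg (hu0 z hz1) m)]
        have h10 := hu0 z hz1
        have h11 := hdec z hz
        gcongr) h1 h2 h3
    have hmem : ∀ z ∈ ball (0 : EuclideanSpace ℝ (Fin n)) 4, x₀ + (ρ / 4) • z ∈ ball x₀ ρ := by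
      intro z hz
      rw [mem_ball_zero_iff] at hz
      rw [mem_ball, dist_eq_norm, add_sub_cancel_left, norm_smul, Real.norm_of_nonneg hρ4.le]
      nlinarith
    have hres := hflat (fun z => u (x₀ + (ρ / 4) • z) / (A * ρ ^ β)) (by
      refine ContinuousOn.div_const (huc.comp (Continuous.continuousOn (by fun_prop)) ?_) _
      exact fun z hz => hball ρ hρρ₀ (hmem z hz)) (fun z hz => by
        refine ⟨div_nonneg (hu0 _ (hball ρ hρρ₀ (hmem z hz))) hMpos.le, ?_⟩
        rw [div_le_one hMpos]
        exact hdec _ (hmem z hz)) (by simp [hux₀]) hclass.1 hclass.2 ((ρ / 4)⁻¹ • (y - x₀)) (by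
        rw [mem_ball, dist_eq_norm] at hy
        rw [mem_ball_zero_iff, norm_smul, norm_inv, Real.norm_of_nonneg hρ4.le,
          inv_mul_lt_iff₀ hρ4, mul_one]
        exact hy)
    simp only [smul_inv_smul₀ hρ4.ne', add_sub_cancel] at hres
    rw [div_le_iff₀ hMpos] at hres
    refine hres.trans (le_of_eq ?_)
    rw [div_eq_mul_one_div ρ, Real.mul_rpow hρ.le (by norm_num)]
    ring
  have hxx : x ≠ x₀ := by
    rintro rfl
    linarith
  have hC : K / ρ₀ ^ β * 4 ^ β * N = A * 4 ^ β := by rw [hA]; ring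
  rw [hC]
  by_cases hxρ : x ∈ ball x₀ ρ₀
  · exact le_of_geometric_decay hA0.le hβ0 hρ₀
      (fun y hy => (hule y (hball ρ₀ le_rfl hy)).trans hNA) hstep hxρ hxx
  · rw [mem_ball, dist_eq_norm, not_lt] at hxρ
    refine (hule x (h21 hx)).trans (hNA.trans ?_)
    have h1 : (1 : ℝ) ≤ 4 ^ β := Real.one_le_rpow (by norm_num) hβ0.le
    calc A * ρ₀ ^ β ≤ A * ‖x - x₀‖ ^ β := by gcongr
      _ ≤ A * 4 ^ β * ‖x - x₀‖ ^ β := by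
          gcongr
          exact le_mul_of_one_le_right hA0.le h1
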